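/- Let $\Gamma$ be a finite simplicial graph, and let $G(\Gamma)$ be the right-angled Artin group with one generator for each vertex of $\Gamma$ (the standard generators) and the relation $[v,w]=1$ for each pair of adjacent vertices $v,w$. The extension graph of $\Gamma$ has as vertices the elements of $G(\Gamma)$ that are conjugate to a standard generator, two distinct ones being adjacent if and only if they commute in $G(\Gamma)$. The extension complex $\mathcal{P}(\Gamma)$ is the flag complex of the extension graph, and $\operatorname{Aut}(\mathcal{P}(\Gamma))$ is its group of simplicial automorphisms. The syllable length $|g|_r$ of $g\in G(\Gamma)$ is the least $l$ such that $g$ is a product of $l$ elements of the form $v^{k}$ with $v$ a standard generator and $k\in\mathbb{Z}$, and the syllable metric on $G(\Gamma)$ is $d_r(g,h)=|g^{-1}h|_r$. Suppose that $\operatorname{Out}(G(\Gamma))$ is finite and that $G(\Gamma)\not\cong\mathbb{Z}$. Then there is an isomorphism of groups $$\operatorname{Aut}(\mathcal{P}(\Gamma))\cong\operatorname{Isom}(G(\Gamma),d_r),$$ where $\operatorname{Isom}(G(\Gamma),d_r)$ is the group of all bijective isometries of $(G(\Gamma),d_r)$. -/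

import Mathlib

/-- The right-angled Artin group of a simple graph `Γ`: one generator for each vertex, and the
relation `v w v⁻¹ w⁻¹ = 1` for each pair of adjacent vertices `v, w`. -/
def RAAG {V : Type*} (Γ : SimpleGraph V) : Type _ :=
  PresentedGroup {r : FreeGroup V | ∃ v w : V, Γ.Adj v w ∧
    r = FreeGroup.of v * FreeGroup.of w * (FreeGroup.of v)⁻¹ * (FreeGroup.of w)⁻¹}

namespace RAAG

variable {V : Type*} (Γ : SimpleGraph V)

instance : Group (RAAG Γ) := inferInstanceAs (Group (PresentedGroup _))

/-- The standard generator attached to a vertex. -/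
def of (v : V) : RAAG Γ := PresentedGroup.of v

theorem closure_range_of : Subgroup.closure (Set.range (of Γ)) = ⊤ :=
  PresentedGroup.closure_range_of _

/-! ### The extension graph and the extension complex -/

/-- Vertices of the extension graph: the elements conjugate to a standard generator. -/
def ExtensionVertex : Type _ := {g : RAAG Γ // ∃ v : V, IsConj (of Γ v) g}

/-- The extension graph: two distinct conjugates of standard generators are adjacent
when they commute. -/
def extensionGraph : SimpleGraph (ExtensionVertex Γ) where
  Adj x y := x ≠ y ∧ Commute x.1 y.1
  symm := ⟨fun _ _ h => ⟨h.1.symm, h.2.symm⟩⟩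
  loopless := ⟨fun _ h => h.1 rfl⟩

end RAAG

/-- The flag complex of a graph: its simplices are the nonempty finite cliques. -/
def SimpleGraph.flagComplex {α : Type*} (G : SimpleGraph α) : AbstractSimplicialComplex α where
  faces := {s : Finset α | s.Nonempty ∧ G.IsClique (s : Set α)}
  isRelLowerSet_faces := fun _ hs =>
    ⟨hs.1, fun _ hts ht => ⟨ht, hs.2.subset (Finset.coe_subset.2 hts)⟩⟩
  singleton_mem v := ⟨Finset.singleton_nonempty v, by simp⟩

/-- The group of simplicial automorphisms of an abstract simplicial complex: the permutations
of the vertex set which, together with their inverses, send simplices to simplices. -/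
def AbstractSimplicialComplex.autGroup {α : Type*} (K : AbstractSimplicialComplex α) :
    Subgroup (Equiv.Perm α) where
  carrier := {e | ∀ s : Finset α, s.map e.toEmbedding ∈ K.faces ↔ s ∈ K.faces}
  one_mem' s := by
    have h : s.map (1 : Equiv.Perm α).toEmbedding = s := Finset.map_refl
    rw [h]
  mul_mem' {a b} ha hb s := by
    have h : s.map (a * b).toEmbedding = (s.map b.toEmbedding).map a.toEmbedding := by
      rw [Finset.map_map]; rfl
    rw [h, ha, hb]
  inv_mem' {a} ha s := by
    have h : (s.map (a⁻¹).toEmbedding).map a.toEmbedding = s := by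
      rw [Finset.map_map]
      have h' : (a⁻¹).toEmbedding.trans a.toEmbedding = Function.Embedding.refl α := by
        ext x; exact a.apply_symm_apply x
      rw [h', Finset.map_refl]
    rw [← ha, h]

namespace RAAG

variable {V : Type*} (Γ : SimpleGraph V)

/-- The extension complex: the flag complex of the extension graph. -/
def extensionComplex : AbstractSimplicialComplex (ExtensionVertex Γ) :=
  (extensionGraph Γ).flagComplex

/-! ### The syllable metric -/

/-- A syllable is an integer power of a standard generator. -/
def IsSyllable (g : RAAG Γ) : Prop := ∃ (v : V) (k : ℤ), g = of Γ v ^ k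

/-- `g` is a product of `n` syllables. -/
def IsProdOfSyllables (g : RAAG Γ) (n : ℕ) : Prop :=
  ∃ l : List (RAAG Γ), (∀ s ∈ l, IsSyllable Γ s) ∧ l.length = n ∧ l.prod = g

/-- The syllable length of `g`: the least `n` such that `g` is a product of `n` syllables. -/
noncomputable def syllableLength (g : RAAG Γ) : ℕ := sInf {n : ℕ | IsProdOfSyllables Γ g n}

variable {Γ}

theorem IsSyllable.inv {g : RAAG Γ} (h : IsSyllable Γ g) : IsSyllable Γ g⁻¹ := by
  obtain ⟨v, k, rfl⟩ := h
  exact ⟨v, -k, by simp⟩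

theorem IsProdOfSyllables.mul {g h : RAAG Γ} {m n : ℕ} (hg : IsProdOfSyllables Γ g m)
    (hh : IsProdOfSyllables Γ h n) : IsProdOfSyllables Γ (g * h) (m + n) := by
  obtain ⟨l, hl, rfl, rfl⟩ := hg
  obtain ⟨l', hl', rfl, rfl⟩ := hh
  refine ⟨l ++ l', fun s hs => ?_, by simp, by simp⟩
  rcases List.mem_append.1 hs with hs | hs
  exacts [hl s hs, hl' s hs]

theorem IsProdOfSyllables.inv {g : RAAG Γ} {n : ℕ} (hg : IsProdOfSyllables Γ g n) :
    IsProdOfSyllables Γ g⁻¹ n := by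
  obtain ⟨l, hl, rfl, rfl⟩ := hg
  refine ⟨(l.map (fun x => x⁻¹)).reverse, fun s hs => ?_, by simp, by
    rw [List.prod_inv_reverse]⟩
  simp only [List.mem_reverse, List.mem_map] at hs
  obtain ⟨a, ha, rfl⟩ := hs
  exact (hl a ha).inv

theorem exists_isProdOfSyllables (g : RAAG Γ) : ∃ n, IsProdOfSyllables Γ g n := by
  have hg : g ∈ Subgroup.closure (Set.range (of Γ)) := by
    rw [closure_range_of]; trivial
  induction hg using Subgroup.closure_induction with
  | mem x hx =>
    obtain ⟨v, rfl⟩ := hx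
    exact ⟨1, [of Γ v], by simpa using ⟨v, 1, by simp⟩, rfl, by simp⟩
  | one => exact ⟨0, [], by simp, rfl, rfl⟩
  | mul x y _ _ hx hy =>
    obtain ⟨m, hm⟩ := hx
    obtain ⟨n, hn⟩ := hy
    exact ⟨m + n, hm.mul hn⟩
  | inv x _ hx =>
    obtain ⟨m, hm⟩ := hx
    exact ⟨m, hm.inv⟩

theorem isProdOfSyllables_syllableLength (g : RAAG Γ) :
    IsProdOfSyllables Γ g (syllableLength Γ g) :=
  Nat.sInf_mem (exists_isProdOfSyllables g)

theorem syllableLength_le {g : RAAG Γ} {n : ℕ} (h : IsProdOfSyllables Γ g n) :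
    syllableLength Γ g ≤ n :=
  Nat.sInf_le h

theorem syllableLength_eq_zero {g : RAAG Γ} : syllableLength Γ g = 0 ↔ g = 1 := by
  constructor
  · intro h
    obtain ⟨l, -, hl, rfl⟩ := isProdOfSyllables_syllableLength g
    rw [h, List.length_eq_zero_iff] at hl
    simp [hl]
  · rintro rfl
    exact Nat.le_zero.1 (syllableLength_le ⟨[], by simp, rfl, rfl⟩)

theorem syllableLength_mul_le (g h : RAAG Γ) :
    syllableLength Γ (g * h) ≤ syllableLength Γ g + syllableLength Γ h :=
  syllableLength_le
    ((isProdOfSyllables_syllableLength g).mul (isProdOfSyllables_syllableLength h))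

theorem syllableLength_inv_le (g : RAAG Γ) : syllableLength Γ g⁻¹ ≤ syllableLength Γ g :=
  syllableLength_le (isProdOfSyllables_syllableLength g).inv

theorem syllableLength_inv (g : RAAG Γ) : syllableLength Γ g⁻¹ = syllableLength Γ g :=
  le_antisymm (syllableLength_inv_le g) (by simpa using syllableLength_inv_le g⁻¹)

/-- The syllable metric: the left-invariant metric `d(g, h) = |g⁻¹ h|` on the right-angled Artin
group, where `|·|` is the syllable length. -/
noncomputable instance : MetricSpace (RAAG Γ) where
  dist g h := (syllableLength Γ (g⁻¹ * h) : ℝ)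
  dist_self g := by simp [syllableLength_eq_zero]
  dist_comm g h := by
    rw [← syllableLength_inv]; simp
  dist_triangle a b c := by
    have h := syllableLength_mul_le (a⁻¹ * b) (b⁻¹ * c)
    rw [show a⁻¹ * b * (b⁻¹ * c) = a⁻¹ * c by group] at h
    exact_mod_cast h
  eq_of_dist_eq_zero {a b} h := by
    have h' : a⁻¹ * b = 1 := syllableLength_eq_zero.1 (by exact_mod_cast h)
    exact inv_mul_eq_one.1 h'

theorem dist_def (g h : RAAG Γ) : dist g h = (syllableLength Γ (g⁻¹ * h) : ℝ) := rfl

end RAAG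

/-- The set `Aut(G) / Inn(G)` underlying the outer automorphism group of `G`. -/
def OuterAut (G : Type*) [Group G] : Type _ := MulAut G ⧸ (MulAut.conj : G →* MulAut G).range

namespace RAAG

/-! ### Standard subgroups, retractions, and centralizers of generators. -/

section Basic

variable {V : Type*} {Γ : SimpleGraph V}

/-! Call a coset `x⟨s⟩` of a standard cyclic subgroup a line. Since the centralizer of `s` is
generated by its closed star (`commute_of_iff`), a vertex `u` of the extension graph is a class of
parallel lines, and pairs of elements at syllable distance one are edges labelled by such vertices.
Projecting to a line of the class gives every group element an integer coordinate at `u`. Moving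
along an edge changes only the coordinate at its label, and the coordinates together determine the
element (`eq_of_coord_eq`).

An isometry respects labels: triangles of edges lie in one line, and induced squares come from two
commuting labels, with opposite sides labelled alike. This yields `isometryHom`, which is injective
because the group has trivial center.

For surjectivity the group must be recovered from the graph. If `w` does not commute with `u`, the
coordinate at `u` is constant on all lines labelled `w`; this value is the sector of `w`. Finiteness
of the outer automorphism group excludes the transvections and partial conjugations that have
infinite order modulo inner automorphisms, which gives `Rigid`. Rigidity makes the sectors at `u`
exactly the components of the extension graph minus the star of `u` (`Rigid.linked_of_sector_eq`),
so a graph automorphism permutes sectors, though not necessarily their integer names. A group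
element amounts to a consistent choice of one sector per vertex that differs from the choice of the
identity at finitely many vertices (`coord_consistent`, `finite_coord_ne`, `exists_coord_eq`). Hence
a graph automorphism acts on elements; it carries edges to edges, so the action is isometric. -/

theorem commute_of {v w : V} (h : Γ.Adj v w) : Commute (of Γ v) (of Γ w) := by
  have h1 : of Γ v * of Γ w * (of Γ v)⁻¹ * (of Γ w)⁻¹ = 1 :=
    PresentedGroup.one_of_mem (rels := {r : FreeGroup V | ∃ v w : V, Γ.Adj v w ∧
      r = FreeGroup.of v * FreeGroup.of w * (FreeGroup.of v)⁻¹ * (FreeGroup.of w)⁻¹})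
      ⟨v, w, h, rfl⟩
  have h2 : of Γ v * of Γ w = of Γ w * of Γ v := by
    rw [mul_inv_eq_one, mul_inv_eq_iff_eq_mul] at h1
    exact h1
  exact h2

/-- A map on vertices that sends adjacent vertices to commuting elements extends to the
right-angled Artin group. -/
def lift {H : Type*} [Group H] (f : V → H) (hf : ∀ v w, Γ.Adj v w → Commute (f v) (f w)) :
    RAAG Γ →* H :=
  PresentedGroup.toGroup (f := f) (by
    rintro _ ⟨v, w, h, rfl⟩
    simp [(hf v w h).eq])

@[simp] theorem lift_of {H : Type*} [Group H] (f : V → H)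
    (hf : ∀ v w, Γ.Adj v w → Commute (f v) (f w)) (v : V) : lift f hf (of Γ v) = f v :=
  PresentedGroup.toGroup.of _

theorem hom_ext {H : Type*} [Group H] {f g : RAAG Γ →* H}
    (h : ∀ v, f (of Γ v) = g (of Γ v)) : f = g :=
  PresentedGroup.ext h

/-- The subgroup generated by a set of standard generators. -/
def span (Γ : SimpleGraph V) (A : Set V) : Subgroup (RAAG Γ) := Subgroup.closure (of Γ '' A)

theorem of_mem_span {A : Set V} {v : V} (h : v ∈ A) : of Γ v ∈ span Γ A :=
  Subgroup.subset_closure ⟨v, h, rfl⟩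

theorem span_mono {A B : Set V} (h : A ⊆ B) : span Γ A ≤ span Γ B :=
  Subgroup.closure_mono (Set.image_mono h)

theorem span_univ : span Γ Set.univ = ⊤ := by
  rw [span, Set.image_univ, closure_range_of]

theorem span_induction {A : Set V} {P : (g : RAAG Γ) → g ∈ span Γ A → Prop}
    (one : P 1 (one_mem _))
    (mul : ∀ g v (k : ℤ) (hg : g ∈ span Γ A) (hv : v ∈ A), P g hg →
      P (g * of Γ v ^ k) (mul_mem hg (zpow_mem (of_mem_span hv) k)))
    {g : RAAG Γ} (hg : g ∈ span Γ A) : P g hg := by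
  refine Subgroup.closure_induction_right one ?_ ?_ hg
  · rintro x hx _ ⟨v, hv, rfl⟩ h
    simpa using mul x v 1 hx hv h
  · rintro x hx _ ⟨v, hv, rfl⟩ h
    simpa using mul x v (-1) hx hv h

theorem induction_right {P : RAAG Γ → Prop} (one : P 1)
    (mul : ∀ g v (k : ℤ), P g → P (g * of Γ v ^ k)) (g : RAAG Γ) : P g :=
  span_induction (A := Set.univ) (P := fun g _ => P g) one (fun g v k _ _ h => mul g v k h)
    (by rw [span_univ]; trivial)

open Classical in
/-- The exponent sum of a standard generator. -/
noncomputable def expo (v : V) : RAAG Γ →* Multiplicative ℤ :=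
  lift (fun w => if w = v then Multiplicative.ofAdd 1 else 1) (fun _ _ _ => Commute.all _ _)

theorem expo_of_self (v : V) : expo v (of Γ v) = Multiplicative.ofAdd 1 := by simp [expo]

theorem expo_of_ne {v w : V} (h : w ≠ v) : expo v (of Γ w) = 1 := by simp [expo, h]

theorem expo_span {A : Set V} {v : V} (hv : v ∉ A) {g : RAAG Γ} (hg : g ∈ span Γ A) :
    expo v g = 1 := by
  induction hg using span_induction with
  | one => simp
  | mul g w k _ hw ih =>
    rw [map_mul, map_zpow, ih, expo_of_ne (by rintro rfl; exact hv hw)]; simp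

theorem expo_conj (v : V) (g h : RAAG Γ) : expo v (g * h * g⁻¹) = expo v h := by
  simp

theorem of_zpow_injective (v : V) : Function.Injective (fun k : ℤ => of Γ v ^ k) := by
  intro k l h
  have := congrArg (expo v) h
  simpa [expo_of_self, ← ofAdd_zsmul] using this

theorem of_zpow_ne_one (v : V) {k : ℤ} (hk : k ≠ 0) : of Γ v ^ k ≠ 1 := fun h =>
  hk (of_zpow_injective v (by simpa using h))

theorem of_injective : Function.Injective (of Γ) := by
  intro v w h
  by_contra hne
  have := congrArg (expo v) h
  rw [expo_of_self, expo_of_ne (Ne.symm hne)] at this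
  exact absurd this (by decide)

open Classical in
/-- The retraction onto the subgroup generated by a set of standard generators. -/
noncomputable def retract (A : Set V) : RAAG Γ →* RAAG Γ :=
  lift (fun w => if w ∈ A then of Γ w else 1) (fun v w h => by
    split_ifs
    exacts [commute_of h, Commute.one_right _, Commute.one_left _, Commute.one_left _])

theorem retract_of_mem {A : Set V} {v : V} (h : v ∈ A) : retract A (of Γ v) = of Γ v := by
  simp [retract, h]

theorem retract_of_notMem {A : Set V} {v : V} (h : v ∉ A) : retract A (of Γ v) = 1 := by
  simp [retract, h]

theorem retract_mem (A : Set V) (g : RAAG Γ) : retract A g ∈ span Γ A := by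
  induction g using induction_right with
  | one => rw [map_one]; exact one_mem _
  | mul g v k ih =>
    rw [map_mul, map_zpow]
    refine mul_mem ih (zpow_mem ?_ k)
    by_cases h : v ∈ A
    · rw [retract_of_mem h]; exact of_mem_span h
    · rw [retract_of_notMem h]; exact one_mem _

theorem retract_eq {A : Set V} {g : RAAG Γ} (hg : g ∈ span Γ A) : retract A g = g := by
  induction hg using span_induction with
  | one => simp
  | mul g v k _ hv ih => rw [map_mul, map_zpow, ih, retract_of_mem hv]

theorem retract_retract (A B : Set V) (g : RAAG Γ) :
    retract A (retract B g) = retract (A ∩ B) g := by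
  have : (retract A).comp (retract B) = retract (Γ := Γ) (A ∩ B) := by
    refine hom_ext fun v => ?_
    by_cases hB : v ∈ B
    · by_cases hA : v ∈ A
      · simp [retract_of_mem hB, retract_of_mem hA, retract_of_mem (A := A ∩ B) ⟨hA, hB⟩]
      · simp [retract_of_mem hB, retract_of_notMem hA,
          retract_of_notMem (A := A ∩ B) (fun h => hA h.1)]
    · simp [retract_of_notMem hB, retract_of_notMem (A := A ∩ B) (fun h => hB h.2)]
  exact DFunLike.congr_fun this g

theorem mem_span_inter {A B : Set V} {g : RAAG Γ} (hA : g ∈ span Γ A) (hB : g ∈ span Γ B) :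
    g ∈ span Γ (A ∩ B) := by
  have h := retract_mem (A ∩ B) g
  rwa [← retract_retract, retract_eq hB, retract_eq hA] at h

/-- A set of generators of least size whose span contains `g` cannot shrink when intersected with
any `A i`, so it lies in all of them. -/
theorem mem_span_iInter [Finite V] {ι : Sort*} {A : ι → Set V} {g : RAAG Γ}
    (h : ∀ i, g ∈ span Γ (A i)) : g ∈ span Γ (⋂ i, A i) := by
  have hex : ∃ n, ∃ S : Set V, g ∈ span Γ S ∧ S.ncard = n :=
    ⟨_, Set.univ, by rw [span_univ]; trivial, rfl⟩
  classical
  obtain ⟨S, hS, hn⟩ := Nat.find_spec hex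
  refine span_mono (Set.subset_iInter fun i => ?_) hS
  have h1 : Nat.find hex ≤ (S ∩ A i).ncard := Nat.find_min' hex ⟨_, mem_span_inter hS (h i), rfl⟩
  have h2 : S ∩ A i = S :=
    Set.eq_of_subset_of_ncard_le Set.inter_subset_left (by omega) (Set.toFinite _)
  exact Set.inter_eq_left.1 h2

/-- The closed star of a vertex. -/
def star (Γ : SimpleGraph V) (v : V) : Set V := {w | w = v ∨ Γ.Adj v w}

theorem self_mem_star (v : V) : v ∈ star Γ v := Or.inl rfl

theorem mem_star_comm {v w : V} : v ∈ star Γ w ↔ w ∈ star Γ v :=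
  or_congr eq_comm (Γ.adj_comm _ _)

theorem commute_of_mem_star {v w : V} (h : w ∈ star Γ v) : Commute (of Γ w) (of Γ v) := by
  rcases h with rfl | h
  exacts [Commute.refl _, (commute_of h).symm]

theorem commute_of_mem_span_star {s : V} {g : RAAG Γ} (hg : g ∈ span Γ (star Γ s)) :
    Commute g (of Γ s) := by
  induction hg using span_induction with
  | one => exact Commute.one_left _
  | mul g v k _ hv ih => exact ih.mul_left ((commute_of_mem_star hv).zpow_left k)

/-! ### The projection to the line of a standard generator -/

open Classical in
/-- The increment of the projection to the line of `s` along the edge from `x` to `x * of t`. -/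
noncomputable def incr (s t : V) (x : RAAG Γ) : ℤ := if t = s ∧ x ∈ span Γ (star Γ s) then 1 else 0

/-- Opposite edges of a commuting square cross the line of `s` equally. This is what makes the count
of crossings respect the defining relations. -/
theorem incr_mul (s t t' : V) (x : RAAG Γ) (h : t' ∈ star Γ t) (k : ℤ) :
    incr s t (x * of Γ t' ^ k) = incr s t x := by
  unfold incr
  congr 1
  simp only [eq_iff_iff, and_congr_right_iff]
  rintro rfl
  exact Subgroup.mul_mem_cancel_right _ (zpow_mem (of_mem_span h) k)

/-- The action of a generator on `RAAG Γ × ℤ` that records the crossings of the line of `s`. -/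
noncomputable def crossingPerm (s t : V) : Equiv.Perm (RAAG Γ × ℤ) where
  toFun p := (p.1 * (of Γ t)⁻¹, p.2 - incr s t p.1)
  invFun p := (p.1 * of Γ t, p.2 + incr s t p.1)
  left_inv p := by
    have := incr_mul s t t p.1 (self_mem_star t) (-1)
    simp only [zpow_neg_one] at this
    ext <;> simp [this]
  right_inv p := by
    have := incr_mul s t t p.1 (self_mem_star t) 1
    simp only [zpow_one] at this
    ext <;> simp [this]

/-- The action of `RAAG Γ` on `RAAG Γ × ℤ` that records the crossings of the line of `s`. -/
noncomputable def crossing (s : V) : RAAG Γ →* Equiv.Perm (RAAG Γ × ℤ) :=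
  lift (crossingPerm s) (fun t t' h => by
    have h1 := fun x => incr_mul s t t' x (Or.inr h) (-1)
    have h2 := fun x => incr_mul s t' t x (Or.inr h.symm) (-1)
    simp only [zpow_neg_one] at h1 h2
    have h3 : (of Γ t)⁻¹ * (of Γ t')⁻¹ = (of Γ t')⁻¹ * (of Γ t)⁻¹ :=
      ((commute_of h).inv_inv).eq
    ext p
    · simp [crossingPerm, mul_assoc, h3]
    · simp only [crossingPerm, Equiv.Perm.coe_mul, Equiv.coe_fn_mk, Function.comp_apply, h1, h2]
      ring)

theorem crossing_of (s t : V) : crossing s (of Γ t) = crossingPerm s t := lift_of _ _ _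

/-- The projection of an element to the line of `s`. -/
noncomputable def proj (s : V) (g : RAAG Γ) : ℤ := (crossing s g⁻¹ (1, 0)).2

theorem crossing_fst (s : V) (g : RAAG Γ) (p : RAAG Γ × ℤ) :
    (crossing s g p).1 = p.1 * g⁻¹ := by
  have hg : g ∈ Subgroup.closure (Set.range (of Γ)) := by rw [closure_range_of]; trivial
  induction hg using Subgroup.closure_induction generalizing p with
  | mem x hx => obtain ⟨v, rfl⟩ := hx; rw [crossing_of]; rfl
  | one => simp
  | mul x y _ _ hx hy => simp [hx, hy, mul_assoc]
  | inv x _ hx =>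
    have h := hx (crossing s x⁻¹ p)
    rw [← Equiv.Perm.mul_apply, ← map_mul, mul_inv_cancel, map_one, Equiv.Perm.one_apply] at h
    rw [h]; simp

@[simp] theorem proj_one (s : V) : proj s (1 : RAAG Γ) = 0 := by simp [proj]

theorem proj_mul_of (s t : V) (g : RAAG Γ) : proj s (g * of Γ t) = proj s g + incr s t g := by
  have h : crossing s (g * of Γ t)⁻¹ (1, 0)
      = (crossingPerm s t).symm (crossing s g⁻¹ (1, 0)) := by
    rw [mul_inv_rev, map_mul, map_inv (crossing s) (of Γ t), crossing_of]
    rfl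
  have h2 := crossing_fst s g⁻¹ (1, 0)
  rw [one_mul, inv_inv] at h2
  rw [proj, h, proj]
  generalize crossing s g⁻¹ (1, 0) = q at h2
  rw [← h2]
  rfl

theorem proj_mul_zpow (s t : V) (g : RAAG Γ) (k : ℤ) :
    proj s (g * of Γ t ^ k) = proj s g + k * incr s t g := by
  have hi := fun n => incr_mul s t t g (self_mem_star t) n
  induction k using Int.induction_on with
  | zero => simp
  | succ n ih => rw [zpow_add_one, ← mul_assoc, proj_mul_of, ih, hi]; ring
  | pred n ih =>
    have h := proj_mul_of s t (g * of Γ t ^ (-(n : ℤ) - 1))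
    rw [mul_assoc, ← zpow_add_one, hi, sub_add_cancel, ih] at h
    linarith

theorem proj_mul_zpow_of_mem {s : V} {g : RAAG Γ} (hg : g ∈ span Γ (star Γ s)) (k : ℤ) :
    proj s (g * of Γ s ^ k) = proj s g + k := by
  rw [proj_mul_zpow]; simp [incr, hg]

theorem proj_mul_zpow_of_not {s t : V} {g : RAAG Γ} (hg : ¬ (t = s ∧ g ∈ span Γ (star Γ s)))
    (k : ℤ) : proj s (g * of Γ t ^ k) = proj s g := by
  rw [proj_mul_zpow]; simp [incr, hg]

theorem proj_mul_left {s : V} {c : RAAG Γ} (hc : c ∈ span Γ (star Γ s)) (g : RAAG Γ) :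
    proj s (c * g) = proj s c + proj s g := by
  induction g using induction_right with
  | one => simp
  | mul g v k ih =>
    have : incr s v (c * g) = incr s v g := by
      unfold incr
      rw [Subgroup.mul_mem_cancel_left _ hc]
    rw [← mul_assoc, proj_mul_zpow, proj_mul_zpow, ih, this, add_assoc]

theorem proj_zpow (s : V) (k : ℤ) : proj s (of Γ s ^ k) = k := by
  have := proj_mul_zpow_of_mem (one_mem (span Γ (star Γ s))) k
  simpa using this

/-- The centralizer of a standard generator is generated by the closed star. -/
theorem commute_of_iff {s : V} {g : RAAG Γ} : Commute g (of Γ s) ↔ g ∈ span Γ (star Γ s) := by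
  refine ⟨fun h => ?_, commute_of_mem_span_star⟩
  by_contra hg
  -- Prepending `s` raises the projection of `g` by one, while appending `s` leaves it unchanged
  -- when `g` is outside the span of the star.
  have h1 := proj_mul_left (of_mem_span (Γ := Γ) (self_mem_star s)) g
  have h2 := proj_mul_zpow_of_not (t := s) (fun h => hg h.2) 1
  have h3 := proj_zpow (Γ := Γ) s 1
  rw [zpow_one] at h2 h3
  rw [← h.eq, h2, h3] at h1
  omega

theorem commute_of_of_iff {s t : V} : Commute (of Γ t) (of Γ s) ↔ t ∈ star Γ s := by
  refine ⟨fun h => ?_, commute_of_mem_star⟩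
  by_contra ht
  have := retract_eq (commute_of_iff.1 h)
  rw [retract_of_notMem ht] at this
  exact of_zpow_ne_one t one_ne_zero (by rw [zpow_one, this])

end Basic

end RAAG

namespace RAAG

/-! ### Lines, carriers and coordinates indexed by the extension graph. -/

section Extension

variable {V : Type*} {Γ : SimpleGraph V}

/-- The conjugate of the standard generator `s` by `x`, as a vertex of the extension graph. -/
def vert (x : RAAG Γ) (s : V) : ExtensionVertex Γ :=
  ⟨x * of Γ s * x⁻¹, s, isConj_iff.2 ⟨x, rfl⟩⟩

theorem exists_vert (u : ExtensionVertex Γ) : ∃ (x : RAAG Γ) (s : V), u = vert x s := by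
  obtain ⟨g, s, h⟩ := u
  obtain ⟨x, rfl⟩ := isConj_iff.1 h
  exact ⟨x, s, rfl⟩

theorem vert_eq_iff {x y : RAAG Γ} {s t : V} :
    vert x s = vert y t ↔ s = t ∧ x⁻¹ * y ∈ span Γ (star Γ s) := by
  have key : x * of Γ s * x⁻¹ = y * of Γ s * y⁻¹ ↔ Commute (x⁻¹ * y) (of Γ s) := by
    rw [commute_iff_eq, mul_inv_eq_iff_eq_mul, ← mul_right_inj x⁻¹, ← mul_left_inj (y⁻¹ * x)⁻¹]
    constructor <;> intro h
    · simpa [mul_assoc] using h.symm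
    · simpa [mul_assoc] using h.symm
  constructor
  · intro h
    have h' : x * of Γ s * x⁻¹ = y * of Γ t * y⁻¹ := congrArg Subtype.val h
    have hst : s = t := by
      by_contra hne
      have := congrArg (expo s) h'
      rw [expo_conj, expo_conj, expo_of_self, expo_of_ne (Ne.symm hne)] at this
      exact absurd this (by decide)
    subst hst
    exact ⟨rfl, commute_of_iff.1 (key.1 h')⟩
  · rintro ⟨rfl, h⟩
    exact Subtype.ext (key.2 (commute_of_iff.2 h))

theorem vert_mul {x c : RAAG Γ} {s : V} (hc : c ∈ span Γ (star Γ s)) :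
    vert (x * c) s = vert x s :=
  (vert_eq_iff.2 ⟨rfl, by simpa using hc⟩).symm

theorem vert_mul_zpow {x : RAAG Γ} {s t : V} (h : t ∈ star Γ s) (k : ℤ) :
    vert (x * of Γ t ^ k) s = vert x s :=
  vert_mul (zpow_mem (of_mem_span h) k)

theorem vert_mul_self (x : RAAG Γ) (s : V) (k : ℤ) : vert (x * of Γ s ^ k) s = vert x s :=
  vert_mul_zpow (self_mem_star s) k

theorem vert_injective (x : RAAG Γ) : Function.Injective (vert x) :=
  fun _ _ h => (vert_eq_iff.1 h).1

/-- Two vertices of the extension graph commute if they are equal or adjacent. -/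
def Com (u w : ExtensionVertex Γ) : Prop := Commute u.1 w.1

theorem Com.refl (u : ExtensionVertex Γ) : Com u u := Commute.refl _

theorem Com.symm {u w : ExtensionVertex Γ} (h : Com u w) : Com w u := Commute.symm h

theorem adj_iff {u w : ExtensionVertex Γ} : (extensionGraph Γ).Adj u w ↔ u ≠ w ∧ Com u w := Iff.rfl

theorem com_iff {u w : ExtensionVertex Γ} : Com u w ↔ u = w ∨ (extensionGraph Γ).Adj u w := by
  rw [adj_iff]
  by_cases h : u = w
  · simp [h, Com.refl]
  · simp [h]

theorem com_vert {x : RAAG Γ} {s t : V} : Com (vert x s) (vert x t) ↔ t ∈ star Γ s := by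
  rw [← commute_of_of_iff, Com, vert, vert, Commute.symm_iff]
  exact Commute.conj_iff x

/-- The carrier of a vertex of the extension graph: the union of the lines it labels. -/
def carrier (u : ExtensionVertex Γ) : Set (RAAG Γ) := {x | ∃ s, u = vert x s}

theorem mem_carrier_vert (x : RAAG Γ) (s : V) : x ∈ carrier (vert x s) := ⟨s, rfl⟩

theorem mul_mem_carrier {u : ExtensionVertex Γ} {c y : RAAG Γ} (hc : Commute c u.1)
    (hy : y ∈ carrier u) : c * y ∈ carrier u := by
  obtain ⟨t, rfl⟩ := hy
  refine ⟨t, Subtype.ext ?_⟩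
  change y * of Γ t * y⁻¹ = c * y * of Γ t * (c * y)⁻¹
  have h : c * (y * of Γ t * y⁻¹) = y * of Γ t * y⁻¹ * c := hc.eq
  rw [← mul_inv_eq_iff_eq_mul] at h
  rw [← h]; group

/-- A chosen element of the carrier. -/
noncomputable def base (u : ExtensionVertex Γ) : RAAG Γ := (exists_vert u).choose

/-- The standard generator to which a vertex of the extension graph is conjugate. -/
noncomputable def typ (u : ExtensionVertex Γ) : V := (exists_vert u).choose_spec.choose

theorem vert_base_typ (u : ExtensionVertex Γ) : vert (base u) (typ u) = u :=
  (exists_vert u).choose_spec.choose_spec.symm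

theorem base_mem_carrier (u : ExtensionVertex Γ) : base u ∈ carrier u :=
  ⟨typ u, (vert_base_typ u).symm⟩

/-- The coordinate of an element of the group at a vertex of the extension graph: its projection
to the corresponding line. -/
noncomputable def coord (u : ExtensionVertex Γ) (x : RAAG Γ) : ℤ := proj (typ u) ((base u)⁻¹ * x)

theorem eq_vert_iff {u : ExtensionVertex Γ} {x : RAAG Γ} {t : V} :
    u = vert x t ↔ t = typ u ∧ (base u)⁻¹ * x ∈ span Γ (star Γ (typ u)) := by
  conv_lhs => rw [← vert_base_typ u]
  rw [vert_eq_iff, eq_comm]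

theorem coord_mul_zpow_of_eq {u : ExtensionVertex Γ} {x : RAAG Γ} {t : V} (h : u = vert x t)
    (k : ℤ) : coord u (x * of Γ t ^ k) = coord u x + k := by
  obtain ⟨rfl, h'⟩ := eq_vert_iff.1 h
  rw [coord, ← mul_assoc, proj_mul_zpow_of_mem h', coord]

theorem coord_mul_zpow_of_ne {u : ExtensionVertex Γ} {x : RAAG Γ} {t : V} (h : u ≠ vert x t)
    (k : ℤ) : coord u (x * of Γ t ^ k) = coord u x := by
  rw [Ne, eq_vert_iff] at h
  rw [coord, ← mul_assoc, proj_mul_zpow_of_not h, coord]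

/-- Some syllable of the word must change the coordinate at `vert x s`. It is a power of `s` and the
prefix before it centralizes `s`, so it can be moved to the front. -/
theorem exists_shorter_of_coord_ne {x : RAAG Γ} {s : V} (l : List (RAAG Γ))
    (hl : ∀ g ∈ l, IsSyllable Γ g)
    (h : coord (vert x s) (x * l.prod) ≠ coord (vert x s) x) :
    ∃ (j : ℤ) (l' : List (RAAG Γ)), (∀ g ∈ l', IsSyllable Γ g) ∧ l'.length + 1 = l.length ∧
      l.prod = of Γ s ^ j * l'.prod := by
  induction l using List.reverseRecOn with
  | nil => simp at h
  | append_singleton l a ih =>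
    obtain ⟨t, k, rfl⟩ := hl a (by simp)
    have hl' : ∀ g ∈ l, IsSyllable Γ g := fun g hg => hl g (by simp [hg])
    by_cases h0 : coord (vert x s) (x * l.prod) = coord (vert x s) x
    · have hv : vert x s = vert (x * l.prod) t := by
        by_contra hne
        refine h ?_
        rw [List.prod_append, List.prod_singleton, ← mul_assoc, coord_mul_zpow_of_ne hne, h0]
      obtain ⟨rfl, hm⟩ := vert_eq_iff.1 hv
      rw [inv_mul_cancel_left] at hm
      refine ⟨k, l, hl', by simp, ?_⟩
      rw [List.prod_append, List.prod_singleton]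
      exact ((commute_of_iff.2 hm).zpow_right k).eq
    · obtain ⟨j, l', h1, h2, h3⟩ := ih hl' h0
      refine ⟨j, l' ++ [of Γ t ^ k], fun g hg => ?_, by simp [← h2], by simp [h3, mul_assoc]⟩
      rcases List.mem_append.1 hg with hg | hg
      · exact h1 g hg
      · rw [List.mem_singleton.1 hg]; exact ⟨t, k, rfl⟩

/-- The syllable distance as a natural number. -/
noncomputable def sdist (x y : RAAG Γ) : ℕ := syllableLength Γ (x⁻¹ * y)

/-- Take the first syllable of a shortest word. If its coordinate agreed at both ends, a later
syllable would undo the change, and merging the two would shorten the word. -/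
theorem exists_first_syllable {x y : RAAG Γ} (h : x ≠ y) :
    ∃ (s : V) (k : ℤ), sdist (x * of Γ s ^ k) y < sdist x y ∧
      coord (vert x s) x ≠ coord (vert x s) y := by
  obtain ⟨l, hl, hn, hp⟩ := isProdOfSyllables_syllableLength (x⁻¹ * y)
  cases l with
  | nil =>
    simp only [List.prod_nil] at hp
    exact absurd (inv_mul_eq_one.1 hp.symm) h
  | cons a l =>
    obtain ⟨s, k, rfl⟩ := hl a (by simp)
    have hl' : ∀ g ∈ l, IsSyllable Γ g := fun g hg => hl g (by simp [hg])
    have hlt : syllableLength Γ (x⁻¹ * y) = l.length + 1 := by rw [← hn]; simp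
    have hy : y = x * of Γ s ^ k * l.prod := by
      rw [List.prod_cons, eq_inv_mul_iff_mul_eq] at hp
      rw [← hp, mul_assoc]
    refine ⟨s, k, ?_, fun hc => ?_⟩
    · rw [sdist, sdist, hlt, Nat.lt_succ_iff]
      exact syllableLength_le ⟨l, hl', rfl, by rw [hy]; group⟩
    · have hk : k ≠ 0 := by
        rintro rfl
        have : syllableLength Γ (x⁻¹ * y) ≤ l.length :=
          syllableLength_le ⟨l, hl', rfl, by rw [hy]; group⟩
        omega
      have h1 : coord (vert (x * of Γ s ^ k) s) (x * of Γ s ^ k * l.prod)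
          ≠ coord (vert (x * of Γ s ^ k) s) (x * of Γ s ^ k) := by
        rw [vert_mul_self, ← hy, ← hc, coord_mul_zpow_of_eq rfl]
        omega
      obtain ⟨j, l', h2, h3, h4⟩ := exists_shorter_of_coord_ne l hl' h1
      have : syllableLength Γ (x⁻¹ * y) ≤ l'.length + 1 :=
        syllableLength_le ⟨of Γ s ^ (k + j) :: l', fun g hg => by
          rcases List.mem_cons.1 hg with rfl | hg
          exacts [⟨s, _, rfl⟩, h2 g hg], by simp, by
          rw [List.prod_cons, zpow_add, hy, h4]; group⟩
      omega

theorem eq_of_coord_eq {x y : RAAG Γ} (h : ∀ u, coord u x = coord u y) : x = y := by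
  by_contra hne
  obtain ⟨s, k, -, hs⟩ := exists_first_syllable hne
  exact hs (h _)

/-- The carrier of `w` is a coset of the span of a star, and is connected by edges whose labels all
commute with `w`; none of these is labelled `u`. -/
theorem coord_eq_of_mem_carrier {u w : ExtensionVertex Γ} (h : ¬ Com u w) {x y : RAAG Γ}
    (hx : x ∈ carrier w) (hy : y ∈ carrier w) : coord u x = coord u y := by
  obtain ⟨t, rfl⟩ := hx
  obtain ⟨t', ht⟩ := hy
  obtain ⟨rfl, hc⟩ := vert_eq_iff.1 ht
  suffices H : ∀ c ∈ span Γ (star Γ t), coord u (x * c) = coord u x by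
    have := H _ hc
    rw [mul_inv_cancel_left] at this
    exact this.symm
  intro c hc
  induction hc using span_induction with
  | one => simp
  | mul c a k hc ha ih =>
    rw [← mul_assoc, coord_mul_zpow_of_ne, ih]
    rintro rfl
    rw [← vert_mul (x := x) hc, com_vert, mem_star_comm] at h
    exact h ha

/-- After translation `u` is a generator `s`, and a conjugate of `t` lies in the span of the star of
`s`. Retracting onto that span replaces the conjugator by one inside it; `t` itself cannot be
killed, since its conjugate is nontrivial. -/
theorem exists_mem_carrier_of_com {u w : ExtensionVertex Γ} (h : Com u w) :
    ∃ x, x ∈ carrier u ∧ x ∈ carrier w := by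
  obtain ⟨x, s, rfl⟩ := exists_vert u
  obtain ⟨y, t, rfl⟩ := exists_vert w
  have hc : Commute (x⁻¹ * y * of Γ t * (x⁻¹ * y)⁻¹) (of Γ s) := by
    rw [← Commute.conj_iff x]
    have : x * (x⁻¹ * y * of Γ t * (x⁻¹ * y)⁻¹) * x⁻¹ = y * of Γ t * y⁻¹ := by group
    rw [this]
    exact h.symm
  have hr := retract_eq (commute_of_iff.1 hc)
  rw [map_mul, map_mul, map_inv] at hr
  have hm := retract_mem (star Γ s) (x⁻¹ * y)
  set r := retract (star Γ s) (x⁻¹ * y)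
  by_cases ht : t ∈ star Γ s
  · rw [retract_of_mem ht] at hr
    refine ⟨x * r, ⟨s, (vert_mul hm).symm⟩, ⟨t, Subtype.ext ?_⟩⟩
    change y * of Γ t * y⁻¹ = x * r * of Γ t * (x * r)⁻¹
    have : x * r * of Γ t * (x * r)⁻¹ = x * (r * of Γ t * r⁻¹) * x⁻¹ := by group
    rw [this, hr]; group
  · rw [retract_of_notMem ht, mul_one, mul_inv_cancel, eq_comm, conj_eq_one_iff] at hr
    exact absurd (by rw [zpow_one, hr]) (of_zpow_ne_one t one_ne_zero)

/-- The distance to the carrier of a vertex. -/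
noncomputable def cdist (u : ExtensionVertex Γ) (x : RAAG Γ) : ℕ :=
  sInf {n | ∃ y ∈ carrier u, sdist x y = n}

theorem cdist_le {u : ExtensionVertex Γ} {x y : RAAG Γ} (hy : y ∈ carrier u) :
    cdist u x ≤ sdist x y := Nat.sInf_le ⟨y, hy, rfl⟩

theorem exists_sdist_eq_cdist (u : ExtensionVertex Γ) (x : RAAG Γ) :
    ∃ y ∈ carrier u, sdist x y = cdist u x :=
  Nat.sInf_mem (s := {n | ∃ y ∈ carrier u, sdist x y = n}) ⟨_, base u, base_mem_carrier u, rfl⟩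

/-- The first edge of a shortest path from `h` to the carrier of `u` cannot commute with `u`, so its
coordinate is constant on that carrier and separates `h` from it. -/
theorem exists_gate {u : ExtensionVertex Γ} {h : RAAG Γ} (hu : h ∉ carrier u) :
    ∃ (s : V) (k : ℤ), ¬ Com (vert h s) u ∧ cdist u (h * of Γ s ^ k) < cdist u h ∧
      ∀ y ∈ carrier u, coord (vert h s) h ≠ coord (vert h s) y := by
  obtain ⟨y, hy, hd⟩ := exists_sdist_eq_cdist u h
  obtain ⟨s, k, hlt, hne⟩ := exists_first_syllable (x := h) (y := y) (by rintro rfl; exact hu hy)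
  have hcom : ¬ Com (vert h s) u := by
    intro hc
    -- The centralizer of `u` preserves its carrier, so the first syllable can be cancelled by
    -- moving the endpoint instead, giving a closer point.
    have h1 : (h * of Γ s * h⁻¹) ^ (-k) * y ∈ carrier u := mul_mem_carrier (Commute.zpow_left hc _) hy
    have h2 := cdist_le (x := h) h1
    have h3 : sdist h ((h * of Γ s * h⁻¹) ^ (-k) * y) = sdist (h * of Γ s ^ k) y := by
      unfold sdist
      rw [conj_zpow]; congr 1; group
    omega
  refine ⟨s, k, hcom, ?_, fun z hz => ?_⟩
  · have := cdist_le (x := h * of Γ s ^ k) hy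
    omega
  · rwa [coord_eq_of_mem_carrier hcom hz hy]

/-- The coordinate at `u` of the carrier of `w`, when `u` and `w` do not commute. -/
noncomputable def sector (u w : ExtensionVertex Γ) : ℤ := coord u (base w)

theorem coord_eq_sector {u w : ExtensionVertex Γ} (h : ¬ Com u w) {y : RAAG Γ}
    (hy : y ∈ carrier w) : coord u y = sector u w :=
  coord_eq_of_mem_carrier h hy (base_mem_carrier w)

theorem sector_eq_of_com {u w w' : ExtensionVertex Γ} (h : ¬ Com u w) (h' : ¬ Com u w')
    (hc : Com w w') : sector u w = sector u w' := by
  obtain ⟨x, hx, hx'⟩ := exists_mem_carrier_of_com hc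
  rw [← coord_eq_sector h hx, coord_eq_sector h' hx']

/-- The coordinates of an element are consistent. -/
theorem coord_consistent {u v : ExtensionVertex Γ} (h : ¬ Com u v) (g : RAAG Γ) :
    coord u g = sector u v ∨ coord v g = sector v u := by
  suffices H : ∀ c, coord u (base v * c) = sector u v ∨ coord v (base v * c) = sector v u by
    simpa using H ((base v)⁻¹ * g)
  intro c
  induction c using induction_right with
  | one => left; rw [mul_one]; rfl
  | mul c t k ih =>
    rw [← mul_assoc]
    -- A step that changes the coordinate at `u` runs inside the carrier of `u`, where the
    -- coordinate at `v` has its constant value.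
    by_cases hu : u = vert (base v * c) t
    · right
      exact coord_eq_sector (fun h' => h h'.symm) ⟨t, by rw [vert_mul_self]; exact hu⟩
    by_cases hv : v = vert (base v * c) t
    · left
      exact coord_eq_sector h ⟨t, by rw [vert_mul_self]; exact hv⟩
    rwa [coord_mul_zpow_of_ne hu, coord_mul_zpow_of_ne hv]

theorem finite_coord_ne (x y : RAAG Γ) : {u | coord u x ≠ coord u y}.Finite := by
  suffices H : ∀ c, {u | coord u x ≠ coord u (x * c)}.Finite by simpa using H (x⁻¹ * y)
  intro c
  induction c using induction_right with
  | one => simp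
  | mul c t k ih =>
    refine (ih.union (Set.finite_singleton (vert (x * c) t))).subset fun u hu => ?_
    by_cases h : u = vert (x * c) t
    · exact Or.inr h
    · left
      change coord u x ≠ _ at hu
      rwa [← mul_assoc, coord_mul_zpow_of_ne h] at hu

end Extension

end RAAG

namespace RAAG

/-! ### Rigidity; sectors as components of complements of stars. -/

section Rigid

variable {V : Type*} {Γ : SimpleGraph V}

/-- The combinatorial consequences of finiteness of the outer automorphism group: no link is
contained in the star of another vertex, no closed star separates, no vertex is adjacent to
all others. -/
structure Rigid (Γ : SimpleGraph V) : Prop where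
  exists_link : ∀ v w : V, v ≠ w → ∃ t, Γ.Adj v t ∧ t ∉ star Γ w
  connected : ∀ (s : V) (P : V → Prop),
    (∀ a b, a ∉ star Γ s → b ∉ star Γ s → Γ.Adj a b → P a → P b) →
    ∀ a b, a ∉ star Γ s → b ∉ star Γ s → P a → P b
  exists_notMem_star : ∀ s : V, ∃ b, b ∉ star Γ s

theorem com_vert_iff {x : RAAG Γ} {c : V} {u : ExtensionVertex Γ} :
    Com (vert x c) u ↔ x⁻¹ * u.1 * x ∈ span Γ (star Γ c) := by
  rw [← commute_of_iff, ← Commute.conj_iff x]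
  have : x * (x⁻¹ * u.1 * x) * x⁻¹ = u.1 := by group
  rw [this]
  exact Commute.symm_iff

theorem Rigid.eq_one_of_commute [Finite V] (hΓ : Rigid Γ) {g : RAAG Γ}
    (h : ∀ s, Commute g (of Γ s)) : g = 1 := by
  have h1 := mem_span_iInter fun s => commute_of_iff.1 (h s)
  have h2 : ⋂ s, star Γ s = ∅ := by
    refine Set.eq_empty_of_forall_notMem fun v hv => ?_
    obtain ⟨b, hb⟩ := hΓ.exists_notMem_star v
    exact hb (mem_star_comm.1 (Set.mem_iInter.1 hv b))
  rw [h2, span, Set.image_empty, Subgroup.closure_empty] at h1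
  exact Subgroup.mem_bot.1 h1

theorem Rigid.exists_not_com [Finite V] (hΓ : Rigid Γ) (g : RAAG Γ) (u : ExtensionVertex Γ) :
    ∃ s, ¬ Com u (vert g s) := by
  by_contra! h
  have h1 : g⁻¹ * u.1 * g = 1 :=
    hΓ.eq_one_of_commute fun s => commute_of_iff.2 (com_vert_iff.1 (h s).symm)
  obtain ⟨y, t, rfl⟩ := exists_vert u
  have h2 := congrArg (expo t) h1
  simp [vert, expo_of_self] at h2

/-- In the extension graph, no link is contained in the star of another vertex. -/
theorem Rigid.exists_adj_not_com [Finite V] (hΓ : Rigid Γ) {x : RAAG Γ} {a : V}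
    {u : ExtensionVertex Γ} (h : vert x a ≠ u) : ∃ c, Γ.Adj a c ∧ ¬ Com (vert x c) u := by
  by_contra! hc
  refine h ?_
  -- If `u` commuted with every neighbour, its conjugate would lie in the intersection of the spans
  -- of their stars. The link condition cuts this down to the powers of `a`, and exponent sums leave
  -- only `a` itself.
  have h1 : x⁻¹ * u.1 * x ∈ span Γ (⋂ c : {c // Γ.Adj a c}, star Γ c.1) :=
    mem_span_iInter fun c => com_vert_iff.1 (hc c.1 c.2)
  have h2 : (⋂ c : {c // Γ.Adj a c}, star Γ c.1) ⊆ {a} := by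
    intro b hb
    by_contra hne
    obtain ⟨t, ht, hb'⟩ := hΓ.exists_link a b (fun h => hne h.symm)
    exact hb' (mem_star_comm.1 (Set.mem_iInter.1 hb ⟨t, ht⟩))
  replace h1 := span_mono h2 h1
  obtain ⟨y, t, rfl⟩ := exists_vert u
  have hexp : ∀ v, expo v (x⁻¹ * (vert y t).1 * x) = expo v (of Γ t) := fun v => by
    simp [vert]
  have hta : t = a := by
    by_contra hne
    have h3 := hexp t
    rw [expo_span (A := {a}) hne h1, expo_of_self] at h3
    exact absurd h3 (by decide)
  subst hta
  rw [span, Set.image_singleton, Subgroup.mem_closure_singleton] at h1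
  obtain ⟨k, hk⟩ := h1
  have h3 := hexp t
  rw [← hk, map_zpow, expo_of_self, ← ofAdd_zsmul] at h3
  have hk1 : k = 1 := by simpa using h3
  rw [hk1, zpow_one] at hk
  refine Subtype.ext ?_
  change x * of Γ t * x⁻¹ = _
  rw [hk]; group

/-- Being linked by a path of the extension graph that avoids the star of `u`. -/
def Linked (u : ExtensionVertex Γ) : ExtensionVertex Γ → ExtensionVertex Γ → Prop :=
  Relation.ReflTransGen fun w w' => ¬ Com u w ∧ ¬ Com u w' ∧ Com w w'

theorem Linked.symm {u w w' : ExtensionVertex Γ} (h : Linked u w w') : Linked u w' w := by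
  induction h with
  | refl => exact .refl
  | tail _ h ih => exact .head ⟨h.2.1, h.1, h.2.2.symm⟩ ih

theorem Linked.trans {u w w' w'' : ExtensionVertex Γ} (h : Linked u w w')
    (h' : Linked u w' w'') : Linked u w w'' := Relation.ReflTransGen.trans h h'

theorem Linked.sector_eq {u w w' : ExtensionVertex Γ} (h : Linked u w w') :
    sector u w = sector u w' := by
  induction h with
  | refl => rfl
  | tail _ h ih => rw [ih, sector_eq_of_com h.1 h.2.1 h.2.2]

theorem Rigid.linked_vert (hΓ : Rigid Γ) {u : ExtensionVertex Γ} {x : RAAG Γ} {a : V}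
    (h : ∀ b, b ∉ star Γ a → ¬ Com u (vert x b)) {b b' : V} (hb : b ∉ star Γ a)
    (hb' : b' ∉ star Γ a) : Linked u (vert x b) (vert x b') :=
  hΓ.connected a (fun c => Linked u (vert x b) (vert x c))
    (fun c d hc hd hcd hl => hl.trans (.single ⟨h c hc, h d hd, com_vert.2 (Or.inr hcd)⟩))
    b b' hb hb' .refl

/-- Powers of `s` in `c` are pulled to the front, where they add up to `m`. The other syllables,
powers of neighbours of `s`, do not leave the component. -/
theorem Rigid.linked_carrier_aux (hΓ : Rigid Γ) {u : ExtensionVertex Γ} {s : V} {c : RAAG Γ}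
    (hc : c ∈ span Γ (star Γ s)) : ∀ y, u = vert y s → ∃ m : ℤ,
      coord u (y * c) = coord u y + m ∧ ∀ b b', b ∉ star Γ s → b' ∉ star Γ s →
        Linked u (vert (y * of Γ s ^ m) b) (vert (y * c) b') := by
  have hin : ∀ y, u = vert y s → ∀ b, b ∉ star Γ s → ¬ Com u (vert y b) := by
    rintro y rfl b hb; rwa [com_vert]
  induction hc using span_induction with
  | one =>
    rintro y hy
    refine ⟨0, by simp, fun b b' hb hb' => ?_⟩
    simpa using hΓ.linked_vert (hin y hy) hb hb'
  | mul c a k hc ha ih =>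
    intro y hy
    have hyc : u = vert (y * c) s := by rw [hy, vert_mul hc]
    rcases ha with rfl | ha
    · have hys : u = vert (y * of Γ a ^ k) a := by rw [vert_mul_self, hy]
      obtain ⟨m, hm, hl⟩ := ih _ hys
      have e : y * of Γ a ^ k * c = y * (c * of Γ a ^ k) := by
        rw [mul_assoc, ((commute_of_iff.2 hc).zpow_right k).eq]
      refine ⟨k + m, ?_, fun b b' hb hb' => ?_⟩
      · rw [← e, hm, coord_mul_zpow_of_eq hy, add_assoc]
      · rw [← e, zpow_add, ← mul_assoc]
        exact hl b b' hb hb'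
    · obtain ⟨m, hm, hl⟩ := ih y hy
      have hyca : u = vert (y * (c * of Γ a ^ k)) s := by
        rw [← mul_assoc, vert_mul_zpow (Or.inr ha), hyc]
      refine ⟨m, ?_, fun b b' hb hb' => ?_⟩
      · rw [← mul_assoc, coord_mul_zpow_of_ne, hm]
        rw [hyc]
        exact fun h => ha.ne (vert_injective _ h)
      -- `b₀` is adjacent to `a`, so its vertex is the same at both ends of the `a`-edge and bridges
      -- the two translates of the graph.
      · obtain ⟨b₀, hb₀, hb₀'⟩ := hΓ.exists_link a s ha.ne'
        refine (hl b b₀ hb hb₀').trans ?_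
        rw [← vert_mul_zpow (x := y * c) (Or.inr hb₀.symm : a ∈ star Γ b₀) k, mul_assoc]
        exact hΓ.linked_vert (hin _ hyca) hb₀' hb'

theorem Rigid.linked_carrier (hΓ : Rigid Γ) {u : ExtensionVertex Γ} {y y' : RAAG Γ}
    (hy : y ∈ carrier u) (hy' : y' ∈ carrier u) (h : coord u y = coord u y') {b b' : V}
    (hb : ¬ Com u (vert y b)) (hb' : ¬ Com u (vert y' b')) :
    Linked u (vert y b) (vert y' b') := by
  obtain ⟨s, hs⟩ := hy
  obtain ⟨s', hs'⟩ := hy'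
  obtain ⟨rfl, hc⟩ := vert_eq_iff.1 (hs.symm.trans hs')
  obtain ⟨m, hm, hl⟩ := hΓ.linked_carrier_aux hc y hs
  rw [mul_inv_cancel_left] at hm hl
  have hm0 : m = 0 := by omega
  rw [hm0, zpow_zero, mul_one] at hl
  rw [hs, com_vert] at hb
  rw [hs', com_vert] at hb'
  exact hl b b' hb hb'

/-- Induction on the distance to the carrier, crossing the edge given by `exists_gate`. Vertices in
the star of its generator are unchanged by the crossing; other vertices are first linked to one of
these that does not commute with `u`. -/
theorem Rigid.exists_linked_carrier [Finite V] (hΓ : Rigid Γ) {u : ExtensionVertex Γ} (n : ℕ) :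
    ∀ (x : RAAG Γ) (b : V), cdist u x ≤ n → ¬ Com u (vert x b) →
      ∃ y ∈ carrier u, ∃ b', ¬ Com u (vert y b') ∧ Linked u (vert x b) (vert y b') := by
  induction n with
  | zero =>
    intro x b hx hb
    by_cases hxu : x ∈ carrier u
    · exact ⟨x, hxu, b, hb, .refl⟩
    · obtain ⟨a, k, -, hlt, -⟩ := exists_gate hxu
      omega
  | succ n ih =>
    intro x b hx hb
    by_cases hxu : x ∈ carrier u
    · exact ⟨x, hxu, b, hb, .refl⟩
    obtain ⟨a, k, hcom, hlt, hsep⟩ := exists_gate hxu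
    have hin : ∀ c, c ∉ star Γ a → ¬ Com u (vert x c) := by
      intro c hc hcu
      obtain ⟨z, hz, hz'⟩ := exists_mem_carrier_of_com hcu
      refine hsep z hz (coord_eq_of_mem_carrier ?_ (mem_carrier_vert x c) hz')
      rwa [com_vert]
    have step : ∀ c, c ∈ star Γ a → ¬ Com u (vert x c) →
        ∃ y ∈ carrier u, ∃ b', ¬ Com u (vert y b') ∧ Linked u (vert x c) (vert y b') := by
      intro c hc hcu
      rw [← vert_mul_zpow (mem_star_comm.1 hc) k] at hcu ⊢
      exact ih _ c (by omega) hcu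
    by_cases hba : b ∈ star Γ a
    · exact step b hba hb
    obtain ⟨c, hac, hcu⟩ := hΓ.exists_adj_not_com (x := x) (a := a) (u := u)
      (by rintro rfl; exact hcom (Com.refl _))
    obtain ⟨t, hct, hta⟩ := hΓ.exists_link c a hac.ne'
    have hcu' : ¬ Com u (vert x c) := fun h => hcu h.symm
    obtain ⟨y, hy, b', hb', hl⟩ := step c (Or.inr hac) hcu'
    refine ⟨y, hy, b', hb', (hΓ.linked_vert hin hba hta).trans (.trans ?_ hl)⟩
    exact .single ⟨hin t hta, hcu', com_vert.2 (Or.inr hct.symm)⟩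

/-- Both vertices can be linked to vertices at points of the carrier of `u`, where the sector is the
coordinate of the point. With `Linked.sector_eq`, this describes sectors by the graph alone. -/
theorem Rigid.linked_of_sector_eq [Finite V] (hΓ : Rigid Γ) {u w w' : ExtensionVertex Γ}
    (hw : ¬ Com u w) (hw' : ¬ Com u w') (h : sector u w = sector u w') : Linked u w w' := by
  rw [← vert_base_typ w] at hw
  rw [← vert_base_typ w'] at hw'
  obtain ⟨y, hy, b, hb, hl⟩ := hΓ.exists_linked_carrier _ _ _ le_rfl hw
  obtain ⟨y', hy', b', hb', hl'⟩ := hΓ.exists_linked_carrier _ _ _ le_rfl hw'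
  have e := hl.sector_eq
  have e' := hl'.sector_eq
  rw [vert_base_typ, ← coord_eq_sector hb (mem_carrier_vert y b)] at e
  rw [vert_base_typ, ← coord_eq_sector hb' (mem_carrier_vert y' b')] at e'
  have := hl.trans ((hΓ.linked_carrier hy hy' (by omega) hb hb').trans hl'.symm)
  rwa [vert_base_typ, vert_base_typ] at this

theorem Rigid.exists_sector_eq (hΓ : Rigid Γ) (u : ExtensionVertex Γ) (n : ℤ) :
    ∃ w, ¬ Com u w ∧ n = sector u w := by
  obtain ⟨x, s, hu⟩ := exists_vert u
  obtain ⟨b, hb⟩ := hΓ.exists_notMem_star s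
  obtain ⟨y, hy, hn⟩ : ∃ y, u = vert y s ∧ coord u y = n :=
    ⟨x * of Γ s ^ (n - coord u x), by rw [vert_mul_self, hu], by
      rw [coord_mul_zpow_of_eq hu]; ring⟩
  have h : ¬ Com u (vert y b) := by rwa [hy, com_vert]
  exact ⟨_, h, by rw [← coord_eq_sector h (mem_carrier_vert _ b), hn]⟩

/-- A consistent system of coordinates that almost agrees with the coordinates of an element is
the system of coordinates of an element. -/
theorem exists_coord_eq {X : ExtensionVertex Γ → ℤ}
    (hX : ∀ u v, ¬ Com u v → X u = sector u v ∨ X v = sector v u) (n : ℕ) :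
    ∀ h : RAAG Γ, {u | X u ≠ coord u h}.Finite → {u | X u ≠ coord u h}.ncard ≤ n →
      ∃ h', ∀ u, X u = coord u h' := by
  induction n with
  | zero =>
    intro h hf hn
    have := (Set.ncard_eq_zero hf).1 (by omega)
    refine ⟨h, fun u => ?_⟩
    by_contra hu
    exact (Set.eq_empty_iff_forall_notMem.1 this u) hu
  | succ n ih =>
    intro h hf hn
    by_cases hne : ∀ u, X u = coord u h
    · exact ⟨h, hne⟩
    push Not at hne
    obtain ⟨u, hu⟩ := hne
    -- A disagreement at `u` is traded for one at an edge leaving `h`: by consistency, agreement at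
    -- the gate towards `u` would force agreement at `u`. Correcting along this edge removes one
    -- disagreement and creates none.
    obtain ⟨s, hs⟩ : ∃ s, X (vert h s) ≠ coord (vert h s) h := by
      by_cases hc : h ∈ carrier u
      · obtain ⟨s, rfl⟩ := hc
        exact ⟨s, hu⟩
      obtain ⟨s, k, hcom, -, hsep⟩ := exists_gate hc
      refine ⟨s, ?_⟩
      rcases hX _ _ hcom with h1 | h1
      · rw [h1]
        exact (hsep _ (base_mem_carrier u)).symm
      · rw [← coord_eq_sector (fun h' => hcom h'.symm) (mem_carrier_vert h s)] at h1
        exact absurd h1 hu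
    set k := X (vert h s) - coord (vert h s) h
    have hss : {u | X u ≠ coord u (h * of Γ s ^ k)} ⊂ {u | X u ≠ coord u h} := by
      refine (Set.ssubset_iff_of_subset fun v hv => ?_).2 ⟨vert h s, hs, fun hv => hv ?_⟩
      · by_cases e : v = vert h s
        · rw [e]; exact hs
        · change X v ≠ _ at hv
          rwa [coord_mul_zpow_of_ne e] at hv
      · rw [coord_mul_zpow_of_eq rfl]
        simp [k]
    exact ih _ (hf.subset hss.subset) (by have := Set.ncard_lt_ncard hss hf; omega)

/-! ### Automorphisms of the extension graph act on the group -/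

variable (F : extensionGraph Γ ≃g extensionGraph Γ)

theorem com_map {u w : ExtensionVertex Γ} : Com (F u) (F w) ↔ Com u w := by
  rw [com_iff, com_iff, F.map_adj_iff, F.injective.eq_iff]

theorem Linked.map {u w w' : ExtensionVertex Γ} (h : Linked u w w') :
    Linked (F u) (F w) (F w') := by
  induction h with
  | refl => exact .refl
  | tail _ h ih => exact ih.trans (.single (by simpa only [com_map] using h))

theorem Rigid.sector_map [Finite V] (hΓ : Rigid Γ) {u w w' : ExtensionVertex Γ}
    (hw : ¬ Com u w) (hw' : ¬ Com u w') :
    sector (F u) (F w) = sector (F u) (F w') ↔ sector u w = sector u w' := by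
  refine ⟨fun h => ?_, fun h => ((hΓ.linked_of_sector_eq hw hw' h).map F).sector_eq⟩
  have h1 := hΓ.linked_of_sector_eq (by rwa [com_map]) (by rwa [com_map]) h
  have h2 := h1.map F.symm
  simp only [RelIso.symm_apply_apply] at h2
  exact h2.sector_eq

/-- The sectors of `h` are the images of the sectors of `g`. -/
def Tracks (g h : RAAG Γ) : Prop :=
  ∀ u w, ¬ Com u w → (coord u g = sector u w ↔ coord (F u) h = sector (F u) (F w))

variable {F}

theorem Tracks.symm {g h : RAAG Γ} (H : Tracks F g h) : Tracks F.symm h g := by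
  intro u w huw
  have := H (F.symm u) (F.symm w) (by rwa [com_map])
  simpa using this.symm

theorem Tracks.coord_eq (hΓ : Rigid Γ) {g g' h h' : RAAG Γ} (H : Tracks F g h)
    (H' : Tracks F g' h') {u : ExtensionVertex Γ} (hu : coord u g = coord u g') :
    coord (F u) h = coord (F u) h' := by
  obtain ⟨w, hw, e⟩ := hΓ.exists_sector_eq u (coord u g)
  rw [(H u w hw).1 e, (H' u w hw).1 (hu ▸ e)]

theorem Tracks.unique (hΓ : Rigid Γ) {g h h' : RAAG Γ} (H : Tracks F g h)
    (H' : Tracks F g h') : h = h' := by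
  refine eq_of_coord_eq fun u => ?_
  have := H.coord_eq hΓ H' (u := F.symm u) rfl
  simpa using this

variable (F) in
-- The automorphism carries the sectors of `g` to a consistent system. Each vertex fails to commute
-- with some vertex labelling a line through `g`, so the system can differ from that of the identity
-- only where the identity is separated from one of finitely many base points.
theorem Rigid.exists_tracks [Finite V] (hΓ : Rigid Γ) (g : RAAG Γ) : ∃ h, Tracks F g h := by
  choose w hw hw' using fun u => hΓ.exists_sector_eq u (coord u g)
  let X : ExtensionVertex Γ → ℤ := fun u => sector u (F (w (F.symm u)))
  have hXF : ∀ u v, ¬ Com u v → (coord u g = sector u v ↔ X (F u) = sector (F u) (F v)) := by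
    intro u v huv
    simp only [X, RelIso.symm_apply_apply]
    rw [hΓ.sector_map F (hw u) huv, ← hw' u]
  have hX : ∀ u v, ¬ Com u v → X u = sector u v ∨ X v = sector v u := by
    intro u v huv
    obtain ⟨u, rfl⟩ := F.surjective u
    obtain ⟨v, rfl⟩ := F.surjective v
    rw [com_map] at huv
    rw [← hXF u v huv, ← hXF v u (fun h => huv h.symm)]
    exact coord_consistent huv g
  have hf : {u | X u ≠ coord u 1}.Finite := by
    refine (Set.finite_iUnion fun s : V =>
      finite_coord_ne (base (F (vert g s))) 1).subset fun u hu => ?_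
    obtain ⟨u, rfl⟩ := F.surjective u
    obtain ⟨s, hs⟩ := hΓ.exists_not_com g u
    have h1 := (hXF u _ hs).1 (coord_eq_sector hs (mem_carrier_vert g s))
    refine Set.mem_iUnion.2 ⟨s, ?_⟩
    change X (F u) ≠ _ at hu
    rwa [h1] at hu
  obtain ⟨h, hh⟩ := exists_coord_eq hX _ 1 hf le_rfl
  refine ⟨h, fun u v huv => ?_⟩
  rw [hXF u v huv, hh]

/-- `u` labels the edge from `x` to `y` of the syllable graph. -/
def EdgeLabel (u : ExtensionVertex Γ) (x y : RAAG Γ) : Prop :=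
  x ≠ y ∧ ∃ (s : V) (k : ℤ), u = vert x s ∧ y = x * of Γ s ^ k

theorem EdgeLabel.coord_eq {u v : ExtensionVertex Γ} {x y : RAAG Γ} (h : EdgeLabel u x y)
    (hv : v ≠ u) : coord v x = coord v y := by
  obtain ⟨-, s, k, rfl, rfl⟩ := h
  rw [coord_mul_zpow_of_ne hv]

/-- The label of a first syllable from `x` to `y` is a differing coordinate, hence is `u`; moving
along that line by the difference makes all coordinates agree. -/
theorem edgeLabel_of_coord {u : ExtensionVertex Γ} {x y : RAAG Γ} (hne : x ≠ y)
    (h : ∀ v, v ≠ u → coord v x = coord v y) : EdgeLabel u x y := by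
  obtain ⟨s, -, -, hs⟩ := exists_first_syllable hne
  have hu : vert x s = u := by
    by_contra hv
    exact hs (h _ hv)
  refine ⟨hne, s, coord u y - coord u x, hu.symm, eq_of_coord_eq fun v => ?_⟩
  by_cases hv : v = u
  · subst hv
    rw [coord_mul_zpow_of_eq hu.symm]; ring
  · rw [coord_mul_zpow_of_ne (hu ▸ hv), h v hv]

theorem Tracks.edgeLabel (hΓ : Rigid Γ) {g g' h h' : RAAG Γ} (H : Tracks F g h)
    (H' : Tracks F g' h') {u : ExtensionVertex Γ} (hu : EdgeLabel u g g') :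
    EdgeLabel (F u) h h' := by
  refine edgeLabel_of_coord ?_ fun v hv => ?_
  · rintro rfl
    exact hu.1 (H.symm.unique hΓ H'.symm)
  · obtain ⟨v, rfl⟩ := F.surjective v
    exact H.coord_eq hΓ H' (hu.coord_eq fun h => hv (h ▸ rfl))

end Rigid

end RAAG

/-! ### Automorphisms of a flag complex and of its graph. -/

theorem SimpleGraph.mem_autGroup_flagComplex {α : Type*} {G : SimpleGraph α} {e : Equiv.Perm α} :
    e ∈ G.flagComplex.autGroup ↔ ∀ a b, G.Adj (e a) (e b) ↔ G.Adj a b := by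
  classical
  constructor
  · intro h a b
    by_cases hab : a = b
    · simp [hab]
    have key : ∀ a b : α, a ≠ b → (({a, b} : Finset α) ∈ G.flagComplex.faces ↔ G.Adj a b) := by
      intro a b hab
      change _ ∧ G.IsClique _ ↔ _
      simp [hab]
    rw [← key a b hab, ← h, ← key _ _ (fun h => hab (e.injective h))]
    simp
  · intro h s
    change s.map e.toEmbedding ∈ {s : Finset α | s.Nonempty ∧ G.IsClique (s : Set α)} ↔
      s ∈ {s : Finset α | s.Nonempty ∧ G.IsClique (s : Set α)}
    have h1 : (s.map e.toEmbedding).Nonempty ↔ s.Nonempty := Finset.map_nonempty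
    have h2 : G.IsClique (s.map e.toEmbedding : Set α) ↔ G.IsClique (s : Set α) := by
      rw [Finset.coe_map, Equiv.coe_toEmbedding, SimpleGraph.IsClique, Set.InjOn.pairwise_image e.injective.injOn]
      simp only [SimpleGraph.IsClique, Set.Pairwise, Function.onFun, h]
    exact and_congr h1 h2

namespace RAAG

/-! ### Isometries of the syllable metric and their action on edge labels. -/

section Isometries

variable {V : Type*} {Γ : SimpleGraph V}

theorem dist_eq_sdist (x y : RAAG Γ) : dist x y = (sdist x y : ℝ) := rfl

theorem EdgeLabel.symm {u : ExtensionVertex Γ} {x y : RAAG Γ} (h : EdgeLabel u x y) :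
    EdgeLabel u y x :=
  edgeLabel_of_coord h.1.symm fun _ hv => (h.coord_eq hv).symm

theorem EdgeLabel.coord_ne {u : ExtensionVertex Γ} {x y : RAAG Γ} (h : EdgeLabel u x y) :
    coord u x ≠ coord u y := fun e =>
  h.1 (eq_of_coord_eq fun v => by
    by_cases hv : v = u
    · rw [hv, e]
    · exact h.coord_eq hv)

theorem EdgeLabel.eq_of_coord_ne {u v : ExtensionVertex Γ} {x y : RAAG Γ} (h : EdgeLabel u x y)
    (hv : coord v x ≠ coord v y) : v = u := by
  by_contra hne
  exact hv (h.coord_eq hne)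

theorem EdgeLabel.unique {u v : ExtensionVertex Γ} {x y : RAAG Γ} (h : EdgeLabel u x y)
    (h' : EdgeLabel v x y) : u = v :=
  h'.eq_of_coord_ne h.coord_ne

theorem EdgeLabel.mem_carrier {u : ExtensionVertex Γ} {x y : RAAG Γ} (h : EdgeLabel u x y) :
    x ∈ carrier u := by
  obtain ⟨-, s, k, rfl, -⟩ := h
  exact mem_carrier_vert x s

theorem edgeLabel_zpow (x : RAAG Γ) (s : V) {k : ℤ} (hk : k ≠ 0) :
    EdgeLabel (vert x s) x (x * of Γ s ^ k) :=
  ⟨fun h => of_zpow_ne_one s hk (by simpa using h.symm), s, k, rfl, rfl⟩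

theorem exists_edgeLabel {u : ExtensionVertex Γ} {x : RAAG Γ} (h : x ∈ carrier u) :
    ∃ y, EdgeLabel u x y := by
  obtain ⟨s, rfl⟩ := h
  exact ⟨_, edgeLabel_zpow x s one_ne_zero⟩

theorem sdist_eq_one_iff {x y : RAAG Γ} : sdist x y = 1 ↔ ∃ u, EdgeLabel u x y := by
  constructor
  · intro h
    obtain ⟨l, hl, hn, hp⟩ := isProdOfSyllables_syllableLength (x⁻¹ * y)
    obtain ⟨a, rfl⟩ := List.length_eq_one_iff.1 (hn.trans h)
    obtain ⟨s, k, rfl⟩ := hl a (by simp)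
    rw [List.prod_singleton, eq_inv_mul_iff_mul_eq] at hp
    refine ⟨vert x s, ?_, s, k, rfl, hp.symm⟩
    rintro rfl
    rw [sdist, inv_mul_cancel, syllableLength_eq_zero.2 rfl] at h
    omega
  · rintro ⟨u, hne, s, k, -, rfl⟩
    have h1 : sdist x (x * of Γ s ^ k) ≤ 1 :=
      syllableLength_le ⟨[of Γ s ^ k], by simpa using ⟨s, k, rfl⟩, rfl, by simp⟩
    have h2 : sdist x (x * of Γ s ^ k) ≠ 0 := fun h =>
      hne (inv_mul_eq_one.1 (syllableLength_eq_zero.1 h))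
    omega

theorem EdgeLabel.triangle {u v w : ExtensionVertex Γ} {x y z : RAAG Γ} (hu : EdgeLabel u x y)
    (hv : EdgeLabel v y z) (hw : EdgeLabel w x z) : u = w := by
  by_cases huv : u = v
  · subst huv
    by_contra hne
    refine hw.coord_ne ?_
    rw [hu.coord_eq (Ne.symm hne), hv.coord_eq (Ne.symm hne)]
  · exact hw.eq_of_coord_ne (by rw [← hv.coord_eq huv]; exact hu.coord_ne)

theorem not_edgeLabel_of_ne {u v : ExtensionVertex Γ} {p q z : RAAG Γ} (huv : u ≠ v)
    (hu : EdgeLabel u p q) (hv : EdgeLabel v q z) (w : ExtensionVertex Γ) :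
    ¬ EdgeLabel w p z := by
  intro hw
  have h1 := hw.eq_of_coord_ne (v := u) (by rw [← hv.coord_eq huv]; exact hu.coord_ne)
  have h2 := hw.eq_of_coord_ne (v := v) (by rw [hu.coord_eq huv.symm]; exact hv.coord_ne)
  exact huv (h1.trans h2.symm)

/-- A coordinate changed along one route from `p` to `z` must change along the other, so opposite
sides share labels. Noncommuting labels are impossible, since `p` and `q` both lie on the carrier of
`v` but differ in the coordinate at `u`. -/
theorem edgeLabel_square {u v b b' : ExtensionVertex Γ} {p q r z : RAAG Γ}
    (hpq : EdgeLabel u p q) (hqz : EdgeLabel b q z) (hpr : EdgeLabel v p r)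
    (hrz : EdgeLabel b' r z) (hpz : p ≠ z) (hpz' : ∀ w, ¬ EdgeLabel w p z) (hqr : q ≠ r)
    (hqr' : ∀ w, ¬ EdgeLabel w q r) : u = b' ∧ Com u v := by
  have huv : u ≠ v := by
    rintro rfl
    exact hqr' u (edgeLabel_of_coord hqr fun w hw => by rw [← hpq.coord_eq hw, hpr.coord_eq hw])
  have hub : u ≠ b := by
    rintro rfl
    exact hpz' u (edgeLabel_of_coord hpz fun w hw => by rw [hpq.coord_eq hw, hqz.coord_eq hw])
  have hvb : v ≠ b' := by
    rintro rfl
    exact hpz' v (edgeLabel_of_coord hpz fun w hw => by rw [hpr.coord_eq hw, hrz.coord_eq hw])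
  have hu : u = b' := hrz.eq_of_coord_ne (by
    rw [← hpr.coord_eq huv, ← hqz.coord_eq hub]; exact hpq.coord_ne)
  have hv : v = b := hqz.eq_of_coord_ne (by
    rw [← hpq.coord_eq huv.symm, ← hrz.coord_eq hvb]; exact hpr.coord_ne)
  refine ⟨hu, ?_⟩
  by_contra hc
  exact hpq.coord_ne (coord_eq_of_mem_carrier hc hpr.mem_carrier (hv ▸ hqz.mem_carrier))

theorem exists_square {u v : ExtensionVertex Γ} {p q r : RAAG Γ} (h : Com u v)
    (hpq : EdgeLabel u p q) (hpr : EdgeLabel v p r) :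
    ∃ z, EdgeLabel v q z ∧ EdgeLabel u r z := by
  obtain ⟨hne, s, k, rfl, rfl⟩ := hpq
  obtain ⟨hne', t, l, rfl, rfl⟩ := hpr
  have hst := com_vert.1 h
  have hk : k ≠ 0 := by rintro rfl; simp at hne
  have hl : l ≠ 0 := by rintro rfl; simp at hne'
  refine ⟨p * of Γ s ^ k * of Γ t ^ l, ?_, ?_⟩
  · rw [← vert_mul_zpow (mem_star_comm.1 hst) k]
    exact edgeLabel_zpow _ _ hl
  · have : p * of Γ s ^ k * of Γ t ^ l = p * of Γ t ^ l * of Γ s ^ k := by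
      rw [mul_assoc, mul_assoc, ((commute_of_mem_star hst).zpow_zpow l k).eq]
    rw [this, ← vert_mul_zpow hst l]
    exact edgeLabel_zpow _ _ hk

variable (f : RAAG Γ ≃ᵢ RAAG Γ)

theorem exists_edgeLabel_map {u : ExtensionVertex Γ} {x y : RAAG Γ} (h : EdgeLabel u x y) :
    ∃ w, EdgeLabel w (f x) (f y) := by
  rw [← sdist_eq_one_iff]
  have h1 : sdist x y = 1 := sdist_eq_one_iff.2 ⟨u, h⟩
  have h2 := f.dist_eq x y
  rw [dist_eq_sdist, dist_eq_sdist, h1] at h2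
  exact_mod_cast h2

theorem exists_edgeLabel_of_map {w : ExtensionVertex Γ} {x y : RAAG Γ}
    (h : EdgeLabel w (f x) (f y)) : ∃ u, EdgeLabel u x y := by
  simpa using exists_edgeLabel_map f.symm h

theorem edgeLabel_map_square {u v : ExtensionVertex Γ} {p q r : RAAG Γ} (huv : u ≠ v)
    (h : Com u v) (hpq : EdgeLabel u p q) (hpr : EdgeLabel v p r) :
    ∃ z, EdgeLabel u r z ∧ ∃ w w', EdgeLabel w (f p) (f q) ∧ EdgeLabel w (f r) (f z) ∧
      EdgeLabel w' (f p) (f r) ∧ Com w w' := by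
  obtain ⟨z, hqz, hrz⟩ := exists_square h hpq hpr
  obtain ⟨w, hw⟩ := exists_edgeLabel_map f hpq
  obtain ⟨w', hw'⟩ := exists_edgeLabel_map f hpr
  obtain ⟨b, hb⟩ := exists_edgeLabel_map f hqz
  obtain ⟨b', hb'⟩ := exists_edgeLabel_map f hrz
  have hpz : p ≠ z := by
    rintro rfl
    exact huv (hpq.unique hqz.symm)
  have hqr : q ≠ r := by
    rintro rfl
    exact huv (hpq.unique hpr)
  obtain ⟨rfl, hc⟩ := edgeLabel_square hw hb hw' hb' (f.injective.ne hpz)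
    (fun a ha => by
      obtain ⟨a', ha'⟩ := exists_edgeLabel_of_map f ha
      exact not_edgeLabel_of_ne huv hpq hqz a' ha') (f.injective.ne hqr)
    (fun a ha => by
      obtain ⟨a', ha'⟩ := exists_edgeLabel_of_map f ha
      exact not_edgeLabel_of_ne huv hpq.symm hpr a' ha')
  exact ⟨z, hrz, w, w', hw, hb', hw', hc⟩

theorem edgeLabel_map_line {u w w' : ExtensionVertex Γ} {x y y' : RAAG Γ} (h : EdgeLabel u x y)
    (h' : EdgeLabel u x y') (hw : EdgeLabel w (f x) (f y)) (hw' : EdgeLabel w' (f x) (f y')) :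
    w = w' := by
  by_cases hy : y = y'
  · subst hy
    exact hw.unique hw'
  · have : EdgeLabel u y y' := edgeLabel_of_coord hy fun v hv => by
      rw [← h.coord_eq hv, h'.coord_eq hv]
    obtain ⟨w'', hw''⟩ := exists_edgeLabel_map f this
    exact hw.triangle hw'' hw'

/-- Edges with one label are joined by moves within a line and across commuting squares, and an
isometry preserves equality of labels under both. -/
theorem edgeLabel_map_unique {u w w' : ExtensionVertex Γ} {x y x' y' : RAAG Γ}
    (h : EdgeLabel u x y) (h' : EdgeLabel u x' y') (hw : EdgeLabel w (f x) (f y))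
    (hw' : EdgeLabel w' (f x') (f y')) : w = w' := by
  obtain ⟨s, hs⟩ := h.mem_carrier
  obtain ⟨s', hs'⟩ := h'.mem_carrier
  obtain ⟨rfl, hc⟩ := vert_eq_iff.1 (hs.symm.trans hs')
  suffices H : ∀ c ∈ span Γ (star Γ s), ∀ y' w', EdgeLabel u (x * c) y' →
      EdgeLabel w' (f (x * c)) (f y') → w = w' by
    have := H _ hc y' w'
    rw [mul_inv_cancel_left] at this
    exact this h' hw'
  clear hw' h' hs' hc
  intro c hc
  induction hc using span_induction with
  | one =>
    intro y' w' h' hw'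
    rw [mul_one] at h' hw'
    exact edgeLabel_map_line f h h' hw hw'
  | mul c a k hc ha ih =>
    intro y' w' h' hw'
    rw [← mul_assoc] at h' hw'
    by_cases hk : k = 0
    · subst hk
      rw [zpow_zero, mul_one] at h' hw'
      exact ih _ _ h' hw'
    have hs2 : u = vert (x * c) s := by rw [vert_mul hc, hs]
    rcases ha with rfl | ha
    · have h1 := edgeLabel_zpow (x * c) a hk
      rw [← hs2] at h1
      obtain ⟨w₁, hw₁⟩ := exists_edgeLabel_map f h1
      rw [ih _ _ h1 hw₁]
      exact edgeLabel_map_line f h1.symm h' hw₁.symm hw'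
    · have h1 := edgeLabel_zpow (x * c) s one_ne_zero
      have h2 := edgeLabel_zpow (x * c) a hk
      rw [← hs2] at h1
      obtain ⟨z, hz, w₁, -, hw₁, hw₂, -⟩ := edgeLabel_map_square f
        (by rw [hs2]; exact fun e => ha.ne (vert_injective _ e))
        (by rw [hs2, com_vert]; exact Or.inr ha) h1 h2
      rw [ih _ _ h1 hw₁]
      exact edgeLabel_map_line f hz h' hw₂ hw'

theorem exists_labelMap (u : ExtensionVertex Γ) :
    ∃ w, ∀ x y, EdgeLabel u x y → EdgeLabel w (f x) (f y) := by
  obtain ⟨y₀, h₀⟩ := exists_edgeLabel (base_mem_carrier u)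
  obtain ⟨w, hw⟩ := exists_edgeLabel_map f h₀
  refine ⟨w, fun x y h => ?_⟩
  obtain ⟨w', hw'⟩ := exists_edgeLabel_map f h
  rwa [edgeLabel_map_unique f h₀ h hw hw']

/-- The action of an isometry on the edge labels. -/
noncomputable def labelMap (u : ExtensionVertex Γ) : ExtensionVertex Γ :=
  (exists_labelMap f u).choose

theorem EdgeLabel.map {u : ExtensionVertex Γ} {x y : RAAG Γ} (h : EdgeLabel u x y) :
    EdgeLabel (labelMap f u) (f x) (f y) :=
  (exists_labelMap f u).choose_spec x y h

theorem labelMap_eq {u w : ExtensionVertex Γ} (h : ∀ x y, EdgeLabel u x y → EdgeLabel w (f x) (f y)) :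
    labelMap f u = w := by
  obtain ⟨y, hy⟩ := exists_edgeLabel (base_mem_carrier u)
  exact (hy.map f).unique (h _ _ hy)

theorem labelMap_mul (f g : RAAG Γ ≃ᵢ RAAG Γ) (u : ExtensionVertex Γ) :
    labelMap (f * g) u = labelMap f (labelMap g u) :=
  labelMap_eq _ fun _ _ h => (h.map g).map f

theorem labelMap_one (u : ExtensionVertex Γ) : labelMap (1 : RAAG Γ ≃ᵢ RAAG Γ) u = u :=
  labelMap_eq _ fun _ _ h => h

/-- The permutation of the edge labels induced by an isometry. -/
noncomputable def labelPerm : Equiv.Perm (ExtensionVertex Γ) where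
  toFun := labelMap f
  invFun := labelMap f⁻¹
  left_inv u := by rw [← labelMap_mul, inv_mul_cancel, labelMap_one]
  right_inv u := by rw [← labelMap_mul, mul_inv_cancel, labelMap_one]

theorem com_labelMap {u v : ExtensionVertex Γ} (h : Com u v) :
    Com (labelMap f u) (labelMap f v) := by
  by_cases huv : u = v
  · subst huv; exact Com.refl _
  obtain ⟨p, hu, hv⟩ := exists_mem_carrier_of_com h
  obtain ⟨q, hq⟩ := exists_edgeLabel hu
  obtain ⟨r, hr⟩ := exists_edgeLabel hv
  obtain ⟨z, -, w, w', h1, -, h2, h3⟩ := edgeLabel_map_square f huv h hq hr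
  rwa [(hq.map f).unique h1, (hr.map f).unique h2]

theorem labelPerm_mem : labelPerm f ∈ (extensionComplex Γ).autGroup := by
  refine SimpleGraph.mem_autGroup_flagComplex.2 fun u v => ?_
  rw [adj_iff, adj_iff, (labelPerm f).injective.ne_iff]
  refine and_congr_right fun _ => ⟨fun h => ?_, com_labelMap f⟩
  have := com_labelMap f⁻¹ h
  change Com ((labelPerm f).symm (labelPerm f u)) ((labelPerm f).symm (labelPerm f v)) at this
  simpa using this

/-- The action of the isometries of the syllable metric on the extension complex. -/
noncomputable def isometryHom : (RAAG Γ ≃ᵢ RAAG Γ) →* (extensionComplex Γ).autGroup where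
  toFun f := ⟨labelPerm f, labelPerm_mem f⟩
  map_one' := Subtype.ext (Equiv.ext labelMap_one)
  map_mul' f g := Subtype.ext (Equiv.ext (labelMap_mul f g))

/-- If all labels are fixed, the lines through `x` and `f x` have the same labels, so `x⁻¹ * f x` is
central. -/
theorem Rigid.isometryHom_injective [Finite V] (hΓ : Rigid Γ) :
    Function.Injective (isometryHom (Γ := Γ)) := by
  rw [injective_iff_map_eq_one]
  intro f hf
  have h1 : ∀ u, labelMap f u = u := fun u => Equiv.congr_fun (congrArg Subtype.val hf) u
  ext x
  refine (inv_mul_eq_one.1 (hΓ.eq_one_of_commute fun s => ?_)).symm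
  have h2 := ((edgeLabel_zpow x s one_ne_zero).map f).mem_carrier
  rw [h1] at h2
  obtain ⟨s', hs⟩ := h2
  exact commute_of_iff.2 (vert_eq_iff.1 hs).2

theorem sdist_map_le {f : RAAG Γ → RAAG Γ}
    (hf : ∀ u x y, EdgeLabel u x y → ∃ w, EdgeLabel w (f x) (f y)) (x y : RAAG Γ) :
    sdist (f x) (f y) ≤ sdist x y := by
  obtain ⟨l, hl, hn, hp⟩ := isProdOfSyllables_syllableLength (x⁻¹ * y)
  rw [eq_inv_mul_iff_mul_eq] at hp
  rw [show sdist x y = l.length from hn.symm, ← hp]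
  clear hn hp
  induction l using List.reverseRecOn with
  | nil => simp [sdist, syllableLength_eq_zero.2]
  | append_singleton l a ih =>
    obtain ⟨s, k, rfl⟩ := hl a (by simp)
    have h1 := ih fun g hg => hl g (by simp [hg])
    rw [List.prod_append, List.prod_singleton, ← mul_assoc, List.length_append,
      List.length_singleton]
    by_cases hk : k = 0
    · rw [hk, zpow_zero, mul_one]; omega
    have h2 := sdist_eq_one_iff.2 (hf _ _ _ (edgeLabel_zpow (x * l.prod) s hk))
    have h3 := syllableLength_mul_le ((f x)⁻¹ * f (x * l.prod))
      ((f (x * l.prod))⁻¹ * f (x * l.prod * of Γ s ^ k))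
    rw [mul_assoc, mul_inv_cancel_left] at h3
    unfold sdist at *
    omega

theorem Rigid.isometryHom_surjective [Finite V] (hΓ : Rigid Γ) :
    Function.Surjective (isometryHom (Γ := Γ)) := by
  rintro ⟨e, he⟩
  let F : extensionGraph Γ ≃g extensionGraph Γ :=
    ⟨e, fun {a b} => SimpleGraph.mem_autGroup_flagComplex.1 he a b⟩
  choose f hf using hΓ.exists_tracks F
  choose f' hf' using hΓ.exists_tracks F.symm
  have hE : ∀ u x y, EdgeLabel u x y → EdgeLabel (F u) (f x) (f y) := fun u x y h =>
    (hf x).edgeLabel hΓ (hf y) h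
  have hE' : ∀ u x y, EdgeLabel u x y → EdgeLabel (F.symm u) (f' x) (f' y) := fun u x y h =>
    (hf' x).edgeLabel hΓ (hf' y) h
  have h1 : ∀ x, f' (f x) = x := fun x => (hf' (f x)).unique hΓ (hf x).symm
  have h2 : ∀ x, f (f' x) = x := fun x => (hf (f' x)).unique hΓ (hf' x).symm
  have hd : ∀ x y, sdist (f x) (f y) = sdist x y := fun x y => by
    refine le_antisymm (sdist_map_le (fun u x y h => ⟨_, hE u x y h⟩) x y) ?_
    have := sdist_map_le (fun u x y h => ⟨_, hE' u x y h⟩) (f x) (f y)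
    rwa [h1, h1] at this
  let φ : RAAG Γ ≃ᵢ RAAG Γ := ⟨⟨f, f', h1, h2⟩, Isometry.of_dist_eq fun x y => by
    rw [dist_eq_sdist, dist_eq_sdist]
    exact_mod_cast hd x y⟩
  exact ⟨φ, Subtype.ext (Equiv.ext fun u => labelMap_eq φ fun x y h => hE u x y h)⟩

end Isometries

end RAAG

/-! ### Finiteness of the outer automorphism group forces rigidity. -/

theorem not_finite_outerAut {G : Type*} [Group G] (T : ℤ → G →* G) (h0 : T 0 = MonoidHom.id G)
    (hadd : ∀ m n, (T m).comp (T n) = T (m + n))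
    (hinn : ∀ k g, (∀ x, T k x = g * x * g⁻¹) → k = 0) : ¬ Finite (OuterAut G) := by
  intro hfin
  let E : ℤ → MulAut G := fun n => (T n).toMulEquiv (T (-n)) (by rw [hadd, neg_add_cancel, h0])
    (by rw [hadd, add_neg_cancel, h0])
  let a : ℤ → OuterAut G := fun n =>
    (QuotientGroup.mk (E n) : MulAut G ⧸ (MulAut.conj : G →* MulAut G).range)
  have ha : Function.Injective a := by
    intro m n h
    obtain ⟨g, hg⟩ := QuotientGroup.eq.1 h
    have := hinn (-m + n) g fun x => by
      rw [← hadd]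
      exact (DFunLike.congr_fun hg x).symm
    omega
  exact (Finite.of_injective a ha).false

namespace RAAG

section FiniteOut

variable {V : Type*} {Γ : SimpleGraph V}

open Classical in
/-- The transvections multiplying `v` by powers of `w`. -/
noncomputable def transvection {v w : V} (h : ∀ t, Γ.Adj v t → t ∈ star Γ w) (n : ℤ) :
    RAAG Γ →* RAAG Γ :=
  lift (fun t => if t = v then of Γ v * of Γ w ^ n else of Γ t) (by
    have key : ∀ t, Γ.Adj v t → Commute (of Γ v * of Γ w ^ n) (of Γ t) := fun t ht =>
      (commute_of ht).mul_left ((commute_of_mem_star (h t ht)).symm.zpow_left n)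
    intro a b hab
    split_ifs with ha hb hb
    · exact Commute.refl _
    · exact key b (ha ▸ hab)
    · exact (key a (hb ▸ hab.symm)).symm
    · exact commute_of hab)

theorem transvection_self {v w : V} (h : ∀ t, Γ.Adj v t → t ∈ star Γ w) (n : ℤ) :
    transvection h n (of Γ v) = of Γ v * of Γ w ^ n := by
  rw [transvection, lift_of, if_pos rfl]

theorem transvection_of_ne {v w t : V} (h : ∀ t, Γ.Adj v t → t ∈ star Γ w) (n : ℤ) (ht : t ≠ v) :
    transvection h n (of Γ t) = of Γ t := by
  rw [transvection, lift_of, if_neg ht]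

theorem exists_link_of_finite (hOut : Finite (OuterAut (RAAG Γ))) {v w : V} (hvw : v ≠ w) :
    ∃ t, Γ.Adj v t ∧ t ∉ star Γ w := by
  by_contra! h
  refine not_finite_outerAut (transvection h) ?_ ?_ ?_ hOut
  · refine hom_ext fun t => ?_
    by_cases ht : t = v
    · subst ht; simp [transvection_self]
    · simp [transvection_of_ne h _ ht]
  · refine fun m n => hom_ext fun t => ?_
    by_cases ht : t = v
    · subst ht
      rw [MonoidHom.comp_apply, transvection_self, transvection_self, map_mul, map_zpow,
        transvection_self, transvection_of_ne h _ hvw.symm, zpow_add, mul_assoc]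
    · simp [transvection_of_ne h _ ht]
  · intro k g hg
    -- Inner automorphisms preserve exponent sums, whereas the transvection adds `k` to that of `w`.
    have := congrArg (expo w) (hg (of Γ v))
    rw [transvection_self, expo_conj, map_mul, map_zpow, expo_of_self, expo_of_ne hvw, one_mul,
      ← ofAdd_zsmul] at this
    simpa using this

open Classical in
/-- The partial conjugations of the generators in `C` by powers of `s`. -/
noncomputable def partialConj {s : V} {C : Set V}
    (h : ∀ a b, Γ.Adj a b → a ∈ C → b ∉ C → b ∈ star Γ s) (n : ℤ) : RAAG Γ →* RAAG Γ :=
  lift (fun t => if t ∈ C then of Γ s ^ n * of Γ t * (of Γ s ^ n)⁻¹ else of Γ t) (by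
    have key : ∀ a b, Γ.Adj a b → a ∈ C → b ∉ C →
        Commute (of Γ s ^ n * of Γ a * (of Γ s ^ n)⁻¹) (of Γ b) := fun a b hab ha hb => by
      have h1 := (commute_of_mem_star (h a b hab ha hb)).symm.zpow_left n
      exact (h1.mul_left (commute_of hab)).mul_left h1.inv_left
    intro a b hab
    split_ifs with ha hb hb
    · exact (Commute.conj_iff _).2 (commute_of hab)
    · exact key a b hab ha hb
    · exact (key b a hab.symm hb ha).symm
    · exact commute_of hab)

theorem partialConj_mem {s t : V} {C : Set V}
    (h : ∀ a b, Γ.Adj a b → a ∈ C → b ∉ C → b ∈ star Γ s) (n : ℤ) (ht : t ∈ C) :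
    partialConj h n (of Γ t) = of Γ s ^ n * of Γ t * (of Γ s ^ n)⁻¹ := by
  rw [partialConj, lift_of, if_pos ht]

theorem partialConj_notMem {s t : V} {C : Set V}
    (h : ∀ a b, Γ.Adj a b → a ∈ C → b ∉ C → b ∈ star Γ s) (n : ℤ) (ht : t ∉ C) :
    partialConj h n (of Γ t) = of Γ t := by
  rw [partialConj, lift_of, if_neg ht]

/-- A disconnected complement of the star of `s` gives partial conjugations by powers of `s` on the
vertices satisfying `P`, fixing `b` but not acting trivially on `a`. -/
theorem connected_of_finite (hOut : Finite (OuterAut (RAAG Γ))) (s : V) (P : V → Prop)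
    (hP : ∀ a b, a ∉ star Γ s → b ∉ star Γ s → Γ.Adj a b → P a → P b) (a b : V)
    (ha : a ∉ star Γ s) (hb : b ∉ star Γ s) (hPa : P a) : P b := by
  by_contra hPb
  let C : Set V := {t | t ∉ star Γ s ∧ P t}
  have h : ∀ a b, Γ.Adj a b → a ∈ C → b ∉ C → b ∈ star Γ s := fun a b hab ha hb => by
    by_contra hbs
    exact hb ⟨hbs, hP a b ha.1 hbs hab ha.2⟩
  have hsC : s ∉ C := fun hs => hs.1 (self_mem_star s)
  refine not_finite_outerAut (partialConj h) ?_ ?_ ?_ hOut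
  · refine hom_ext fun t => ?_
    by_cases ht : t ∈ C
    · simp [partialConj_mem h _ ht]
    · simp [partialConj_notMem h _ ht]
  · refine fun m n => hom_ext fun t => ?_
    by_cases ht : t ∈ C
    · rw [MonoidHom.comp_apply, partialConj_mem h _ ht, partialConj_mem h _ ht, map_mul, map_mul,
        map_inv, map_zpow, partialConj_mem h _ ht, partialConj_notMem h _ hsC, add_comm, zpow_add]
      group
    · simp [partialConj_notMem h _ ht]
  · intro k g hg
    have h1 := hg (of Γ a)
    have h2 := hg (of Γ b)
    rw [partialConj_mem h k ⟨ha, hPa⟩] at h1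
    rw [partialConj_notMem h k (fun h => hPb h.2)] at h2
    -- If the map is conjugation by `g`, then `g` centralizes `b` and `s⁻ᵏ g` centralizes `a`. As
    -- `s` lies in neither star, both elements have exponent sum zero in `s`, so `k = 0`.
    have h3 : Commute g (of Γ b) := (mul_inv_eq_iff_eq_mul.1 h2.symm)
    have h4 : Commute ((of Γ s ^ k)⁻¹ * g) (of Γ a) := by
      have h5 : of Γ a = (of Γ s ^ k)⁻¹ * (g * of Γ a * g⁻¹) * of Γ s ^ k := by rw [← h1]; group
      have h6 : (of Γ s ^ k)⁻¹ * g * of Γ a = of Γ a * ((of Γ s ^ k)⁻¹ * g) := by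
        conv_rhs => rw [h5]
        group
      exact h6
    have h5 := expo_span (v := s) (fun h => hb (mem_star_comm.1 h)) (commute_of_iff.1 h3)
    have h6 := expo_span (v := s) (fun h => ha (mem_star_comm.1 h)) (commute_of_iff.1 h4)
    rw [map_mul, h5, mul_one, map_inv, inv_eq_one, map_zpow, expo_of_self, ← ofAdd_zsmul] at h6
    simpa using h6

theorem nonempty_mulEquiv_int {s : V} (h : ∀ t, t = s) :
    Nonempty (RAAG Γ ≃* Multiplicative ℤ) := by
  refine ⟨MulEquiv.ofBijective (expo s) ⟨?_, fun k => ⟨of Γ s ^ k.toAdd, ?_⟩⟩⟩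
  · rw [injective_iff_map_eq_one]
    intro g hg
    have h1 : g ∈ span Γ {s} :=
      span_mono (A := Set.univ) (fun t _ => h t) (by rw [span_univ]; trivial)
    rw [span, Set.image_singleton, Subgroup.mem_closure_singleton] at h1
    obtain ⟨k, rfl⟩ := h1
    rw [map_zpow, expo_of_self, ← ofAdd_zsmul] at hg
    have : k = 0 := by simpa using hg
    rw [this, zpow_zero]
  · rw [map_zpow, expo_of_self, ← ofAdd_zsmul]
    simp

theorem rigid_of_finite_outerAut (hOut : Finite (OuterAut (RAAG Γ)))
    (hZ : IsEmpty (RAAG Γ ≃* Multiplicative ℤ)) : Rigid Γ where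
  exists_link _ _ := exists_link_of_finite hOut
  connected := connected_of_finite hOut
  exists_notMem_star s := by
    -- If the star of `s` is everything, any other vertex has its link inside that star, contrary to
    -- the link condition; with no other vertex the group is infinite cyclic.
    by_contra! h
    by_cases hs : ∀ t, t = s
    · exact hZ.elim (nonempty_mulEquiv_int hs).some
    · push Not at hs
      obtain ⟨t, ht⟩ := hs
      obtain ⟨r, -, hr⟩ := exists_link_of_finite hOut ht
      exact hr (h r)

end FiniteOut

end RAAG

theorem corollary4p16 {V : Type*} [Finite V] (Γ : SimpleGraph V)
    (hOut : Finite (OuterAut (RAAG Γ)))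
    (hZ : IsEmpty (RAAG Γ ≃* Multiplicative ℤ)) :
    Nonempty ((RAAG.extensionComplex Γ).autGroup ≃* (RAAG Γ ≃ᵢ RAAG Γ)) := by
  have hΓ := RAAG.rigid_of_finite_outerAut hOut hZ
  exact ⟨(MulEquiv.ofBijective RAAG.isometryHom
    ⟨hΓ.isometryHom_injective, hΓ.isometryHom_surjective⟩).symm⟩
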